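/- **Notation.** Let $n\in\mathbb N_0$; functions are real-valued and identified when equal almost everywhere. For a real number $\sigma\ge 0$ and $1\le q<\infty$ write $\sigma=k+\theta$ with $k\in\mathbb N_0$, $\theta\in[0,1)$. The Sobolev–Slobodeckij space $W^{\sigma,q}(\mathbb R^n)$ is the space of all $u\in L^q(\mathbb R^n)$ whose weak derivatives $\partial^\nu u$, $|\nu|\le k$, exist and for which $$\|u\|_{W^{\sigma,q}(\mathbb R^n)}:=\sum_{|\nu|\le k}\|\partial^\nu u\|_{L^q}+\sum_{|\nu|=k}|\partial^\nu u|_{\theta,q}<\infty,\qquad |w|_{\theta,q}:=\Big(\iint_{\mathbb R^n\times\mathbb R^n}\frac{|w(x)-w(y)|^q}{|x-y|^{n+\theta q}}\,dx\,dy\Big)^{1/q},$$ where the second sum is omitted if $\theta=0$. For an open set $\Omega\subseteq\mathbb R^n$, $W^{\sigma,q}(\Omega)$ is the space of restrictions to $\Omega$ of elements of $W^{\sigma,q}(\mathbb R^n)$, with norm $\|u\|_{W^{\sigma,q}(\Omega)}:=\inf\{\|v\|_{W^{\sigma,q}(\mathbb R^n)}: v\in W^{\sigma,q}(\mathbb R^n),\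 v|_\Omega=u\}$. **Theorem.** Let $s\in\mathbb N_0$, let $s_1,s_2$ be real numbers with $s_i\ge s$ ($i=1,2$), and let $1\le p,p_1,p_2<\infty$ be real numbers with $n\big(\frac1{p_1}+\frac1{p_2}-\frac1p\big)\ge 0$. Assume that one of the following holds: (a) $s_i-s\ge n\big(\frac1{p_i}-\frac1p\big)$ for $i=1,2$, and $s_1+s_2-s> n\big(\frac1{p_1}+\frac1{p_2}-\frac1p\big)$; (b) $s_i-s> n\big(\frac1{p_i}-\frac1p\big)$ for $i=1,2$, and $s_1+s_2-s\ge n\big(\frac1{p_1}+\frac1{p_2}-\frac1p\big)$. If $u\in W^{s_1,p_1}(\mathbb R^n)$ and $v\in W^{s_2,p_2}(\mathbb R^n)$, then $uv\in W^{s,p}(\mathbb R^n)$, and pointwise multiplication is a continuous bilinear map $$W^{s_1,p_1}(\mathbb R^n)\times W^{s_2,p_2}(\mathbb R^n)\to W^{s,p}(\mathbb R^n).$$ Moreover, for every open set $\Omega\subseteq\mathbb R^n$ (in particular for every bounded open set with Lipschitz continuous boundary), pointwise multiplication is likewise a continuous bilinear map $W^{s_1,p_1}(\Omega)\times W^{s_2,p_2}(\Omega)\to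 W^{s,p}(\Omega)$. -/

import Mathlib

open MeasureTheory Set Filter
open scoped ENNReal ContDiff

noncomputable section

/-! ### Extended norms and the normed space of vectors of finite norm -/

/-- A norm on a real vector space that may take the value `∞`. -/
structure ExtNorm (V : Type*) [AddCommGroup V] [Module ℝ V] where
  toFun : V → ℝ≥0∞
  eq_zero' : ∀ v, toFun v = 0 → v = 0
  add_le' : ∀ v w, toFun (v + w) ≤ toFun v + toFun w
  smul_le' : ∀ (c : ℝ) v, toFun (c • v) ≤ ‖c‖ₑ * toFun v

namespace ExtNorm

variable {V : Type*} [AddCommGroup V] [Module ℝ V] (N : ExtNorm V)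

theorem map_zero : N.toFun 0 = 0 := by
  simpa using N.smul_le' 0 0

/-- The subspace of the vectors of finite norm. -/
def finiteSubspace : Submodule ℝ V where
  carrier := {v | N.toFun v < ⊤}
  add_mem' := fun {a b} ha hb => (N.add_le' a b).trans_lt (ENNReal.add_lt_top.2 ⟨ha, hb⟩)
  zero_mem' := by simp [N.map_zero]
  smul_mem' := fun c v hv => (N.smul_le' c v).trans_lt (ENNReal.mul_lt_top enorm_lt_top hv)

instance : Norm N.finiteSubspace := ⟨fun v => (N.toFun v.1).toReal⟩

theorem norm_def (v : N.finiteSubspace) : ‖v‖ = (N.toFun v.1).toReal := rfl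

theorem norm_smul_le_aux (c : ℝ) (v : N.finiteSubspace) : ‖c • v‖ ≤ ‖c‖ * ‖v‖ := by
  rw [norm_def, norm_def]
  have h := ENNReal.toReal_mono (ENNReal.mul_lt_top enorm_lt_top v.2).ne (N.smul_le' c v.1)
  simpa [ENNReal.toReal_mul] using h

theorem norm_neg_aux (v : N.finiteSubspace) : ‖-v‖ = ‖v‖ := by
  have h : ∀ w : N.finiteSubspace, ‖-w‖ ≤ ‖w‖ := fun w => by
    simpa using N.norm_smul_le_aux (-1) w
  refine le_antisymm (h v) ?_
  simpa using h (-v)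

instance : NormedAddCommGroup N.finiteSubspace :=
  AddGroupNorm.toNormedAddCommGroup
    { toFun := fun v => ‖v‖
      map_zero' := by simp [norm_def, N.map_zero]
      add_le' := fun v w => by
        simp only [norm_def]
        rw [← ENNReal.toReal_add v.2.ne w.2.ne]
        exact ENNReal.toReal_mono (ENNReal.add_lt_top.2 ⟨v.2, w.2⟩).ne (N.add_le' v.1 w.1)
      neg' := N.norm_neg_aux
      eq_zero_of_map_eq_zero' := fun v hv => by
        have h := (ENNReal.toReal_eq_zero_iff _).1 hv
        exact Subtype.ext (N.eq_zero' v.1 (h.resolve_right v.2.ne)) }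

instance : NormedSpace ℝ N.finiteSubspace where
  norm_smul_le := N.norm_smul_le_aux

end ExtNorm

/-! ### Weak derivatives -/

/-- `ℝⁿ` with its Euclidean norm and Lebesgue measure. -/
abbrev Rn (n : ℕ) : Type := EuclideanSpace ℝ (Fin n)

/-- The classical partial derivative `∂f/∂xᵢ`. -/
def partialD {n : ℕ} (i : Fin n) (f : Rn n → ℝ) : Rn n → ℝ :=
  fun x => fderiv ℝ f x (EuclideanSpace.single i 1)

/-- The classical derivative `∂^ν f` of order `ν = (ν₁, …, νₙ)`. -/
def multiD {n : ℕ} (ν : Fin n → ℕ) (f : Rn n → ℝ) : Rn n → ℝ :=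
  (List.finRange n).foldr (fun i g => (partialD i)^[ν i] g) f

/-- `w` is the weak (distributional) derivative of `u` of order `ν`. -/
def IsWeakDeriv {n : ℕ} (ν : Fin n → ℕ) (u w : Rn n → ℝ) : Prop :=
  LocallyIntegrable u ∧ LocallyIntegrable w ∧
    ∀ φ : Rn n → ℝ, ContDiff ℝ ∞ φ → HasCompactSupport φ →
      ∫ x, multiD ν φ x * u x = (-1) ^ (∑ i, ν i) * ∫ x, φ x * w x

/-- `u` has a weak derivative of order `ν` (as a locally integrable function). -/
def HasWeakDeriv {n : ℕ} (ν : Fin n → ℕ) (u : Rn n → ℝ) : Prop :=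
  ∃ w, IsWeakDeriv ν u w

open Classical in
/-- The weak derivative of order `ν` (unique up to null sets), and `0` if there is none. -/
def weakDeriv {n : ℕ} (ν : Fin n → ℕ) (u : Rn n → ℝ) : Rn n → ℝ :=
  if h : HasWeakDeriv ν u then h.choose else 0

/-- The finite set of the multi-indices `ν ∈ ℕⁿ` with `|ν| = k`. -/
def multiIdx (n k : ℕ) : Finset (Fin n → ℕ) := Finset.piAntidiag Finset.univ k

/-! ### The Sobolev-Slobodeckij norm -/

/-- The Slobodeckij seminorm
`(∬ |u(x) - u(y)|^p / |x - y|^(n + θ p) dx dy)^(1/p)`, with values in `[0, ∞]`. -/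
def slobodeckij {n : ℕ} (θ p : ℝ) (u : Rn n → ℝ) : ℝ≥0∞ :=
  (∫⁻ z : Rn n × Rn n, ‖u z.1 - u z.2‖ₑ ^ p / ‖z.1 - z.2‖ₑ ^ ((n : ℝ) + θ * p)) ^ (1 / p)

open Classical in
/-- The norm of `W^{s,p}(ℝⁿ)` for real `s ≥ 0` and `1 ≤ p < ∞`, with values in `[0, ∞]`. With
`k = ⌊s⌋` and `θ = s - k` it is `∑_{|ν| ≤ k} ‖∂^ν u‖_p`, plus `∑_{|ν| = k} |∂^ν u|_{θ,p}` if `s`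
is not an integer; it is `∞` if some weak derivative of order at most `k` does not exist. -/
def sobolevENorm {n : ℕ} (s p : ℝ) (u : Rn n → ℝ) : ℝ≥0∞ :=
  if ∀ m ≤ ⌊s⌋₊, ∀ ν ∈ multiIdx n m, HasWeakDeriv ν u then
    (∑ m ∈ Finset.range (⌊s⌋₊ + 1), ∑ ν ∈ multiIdx n m,
      eLpNorm (weakDeriv ν u) (ENNReal.ofReal p) volume) +
    (if Int.fract s = 0 then 0 else
      ∑ ν ∈ multiIdx n ⌊s⌋₊, slobodeckij (Int.fract s) p (weakDeriv ν u))
  else ⊤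

/-! ### The norm axioms -/

section Lemmas

variable {n : ℕ}

theorem partialD_smooth (i : Fin n) {f : Rn n → ℝ} (hf : ContDiff ℝ ∞ f) :
    ContDiff ℝ ∞ (partialD i f) :=
  (hf.fderiv_right (m := ∞) (by simp)).clm_apply contDiff_const

theorem partialD_compact (i : Fin n) {f : Rn n → ℝ} (hf : HasCompactSupport f) :
    HasCompactSupport (partialD i f) :=
  hf.fderiv_apply ℝ _

theorem multiD_test (ν : Fin n → ℕ) {f : Rn n → ℝ} (hf : ContDiff ℝ ∞ f)
    (hc : HasCompactSupport f) : ContDiff ℝ ∞ (multiD ν f) ∧ HasCompactSupport (multiD ν f) := by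
  have h1 : ∀ (i : Fin n) (k : ℕ) (g : Rn n → ℝ), ContDiff ℝ ∞ g ∧ HasCompactSupport g →
      ContDiff ℝ ∞ ((partialD i)^[k] g) ∧ HasCompactSupport ((partialD i)^[k] g) := by
    intro i k
    induction k with
    | zero => intro g hg; exact hg
    | succ k ih =>
      intro g hg
      exact ih _ ⟨partialD_smooth i hg.1, partialD_compact i hg.2⟩
  unfold multiD
  induction List.finRange n with
  | nil => exact ⟨hf, hc⟩
  | cons i l ih => exact h1 i (ν i) _ ih

theorem test_integrable {φ u : Rn n → ℝ} (hf : ContDiff ℝ ∞ φ)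
    (hc : HasCompactSupport φ) (hu : LocallyIntegrable u) : Integrable (fun x => φ x * u x) := by
  simpa using hu.integrable_smul_left_of_hasCompactSupport hf.continuous hc

theorem IsWeakDeriv.unique {ν : Fin n → ℕ} {u w w' : Rn n → ℝ} (h : IsWeakDeriv ν u w)
    (h' : IsWeakDeriv ν u w') : w =ᵐ[volume] w' := by
  refine ae_eq_of_integral_contDiff_smul_eq h.2.1 h'.2.1 fun φ hf hc => ?_
  have e := (h.2.2 φ hf hc).symm.trans (h'.2.2 φ hf hc)
  simpa using e

theorem IsWeakDeriv.congr {ν : Fin n → ℕ} {u u' w : Rn n → ℝ} (h : IsWeakDeriv ν u w)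
    (e : u =ᵐ[volume] u') : IsWeakDeriv ν u' w := by
  refine ⟨(locallyIntegrable_congr e).1 h.1, h.2.1, fun φ hf hc => ?_⟩
  rw [← h.2.2 φ hf hc]
  refine integral_congr_ae ?_
  filter_upwards [e] with x hx
  rw [hx]

theorem IsWeakDeriv.add {ν : Fin n → ℕ} {u u' w w' : Rn n → ℝ} (h : IsWeakDeriv ν u w)
    (h' : IsWeakDeriv ν u' w') : IsWeakDeriv ν (u + u') (w + w') := by
  refine ⟨h.1.add h'.1, h.2.1.add h'.2.1, fun φ hf hc => ?_⟩
  obtain ⟨hf', hc'⟩ := multiD_test ν hf hc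
  simp only [Pi.add_apply, mul_add]
  rw [integral_add (test_integrable hf' hc' h.1) (test_integrable hf' hc' h'.1),
    integral_add (test_integrable hf hc h.2.1) (test_integrable hf hc h'.2.1),
    h.2.2 φ hf hc, h'.2.2 φ hf hc]
  ring

theorem IsWeakDeriv.smul {ν : Fin n → ℕ} {u w : Rn n → ℝ} (h : IsWeakDeriv ν u w) (c : ℝ) :
    IsWeakDeriv ν (c • u) (c • w) := by
  refine ⟨h.1.smul c, h.2.1.smul c, fun φ hf hc => ?_⟩
  simp only [Pi.smul_apply, smul_eq_mul, mul_left_comm _ c, integral_const_mul]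
  rw [h.2.2 φ hf hc, mul_left_comm]

theorem HasWeakDeriv.isWeakDeriv {ν : Fin n → ℕ} {u : Rn n → ℝ} (h : HasWeakDeriv ν u) :
    IsWeakDeriv ν u (weakDeriv ν u) := by
  rw [weakDeriv, dif_pos h]
  exact h.choose_spec

theorem IsWeakDeriv.weakDeriv_eq {ν : Fin n → ℕ} {u w : Rn n → ℝ} (h : IsWeakDeriv ν u w) :
    weakDeriv ν u =ᵐ[volume] w :=
  IsWeakDeriv.unique (HasWeakDeriv.isWeakDeriv ⟨w, h⟩) h

theorem slobodeckij_congr (θ p : ℝ) {u v : Rn n → ℝ} (h : u =ᵐ[volume] v) :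
    slobodeckij θ p u = slobodeckij θ p v := by
  unfold slobodeckij
  congr 1
  refine lintegral_congr_ae ?_
  have e1 : ∀ᵐ z : Rn n × Rn n, u z.1 = v z.1 := Measure.quasiMeasurePreserving_fst.ae h
  have e2 : ∀ᵐ z : Rn n × Rn n, u z.2 = v z.2 := Measure.quasiMeasurePreserving_snd.ae h
  filter_upwards [e1, e2] with z h1 h2
  rw [h1, h2]

theorem slobodeckij_eq (θ : ℝ) {p : ℝ} (hp : 1 ≤ p) (u : Rn n → ℝ) :
    slobodeckij θ p u = (∫⁻ z : Rn n × Rn n,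
      (‖u z.1 - u z.2‖ₑ / ‖z.1 - z.2‖ₑ ^ (((n : ℝ) + θ * p) / p)) ^ p) ^ (1 / p) := by
  unfold slobodeckij
  congr 2
  funext z
  rw [ENNReal.div_rpow_of_nonneg _ _ (by linarith), ← ENNReal.rpow_mul,
    div_mul_cancel₀ _ (by linarith : p ≠ 0)]

theorem slobodeckij_add_le (θ : ℝ) {p : ℝ} (hp : 1 ≤ p) {u v : Rn n → ℝ}
    (hu : LocallyIntegrable u) (hv : LocallyIntegrable v) :
    slobodeckij θ p (u + v) ≤ slobodeckij θ p u + slobodeckij θ p v := by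
  have meas : ∀ w : Rn n → ℝ, LocallyIntegrable w → AEMeasurable (fun z : Rn n × Rn n =>
      ‖w z.1 - w z.2‖ₑ / ‖z.1 - z.2‖ₑ ^ (((n : ℝ) + θ * p) / p)) volume := by
    intro w hw
    have h1 : AEMeasurable (fun z : Rn n × Rn n => w z.1 - w z.2) volume :=
      (hw.aestronglyMeasurable.comp_fst.sub hw.aestronglyMeasurable.comp_snd).aemeasurable
    refine h1.enorm.div ?_
    exact (((measurable_fst.sub measurable_snd).enorm).pow_const _).aemeasurable
  rw [slobodeckij_eq θ hp, slobodeckij_eq θ hp, slobodeckij_eq θ hp]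
  refine le_trans ?_ (ENNReal.lintegral_Lp_add_le (meas u hu) (meas v hv) hp)
  refine ENNReal.rpow_le_rpow (lintegral_mono fun z => ?_) (by positivity)
  refine ENNReal.rpow_le_rpow ?_ (by linarith)
  simp only [Pi.add_apply]
  rw [← ENNReal.add_div]
  refine ENNReal.div_le_div_right ?_ _
  rw [add_sub_add_comm]
  exact enorm_add_le _ _

theorem slobodeckij_smul_le (θ : ℝ) {p : ℝ} (hp : 1 ≤ p) (c : ℝ) (u : Rn n → ℝ) :
    slobodeckij θ p (c • u) ≤ ‖c‖ₑ * slobodeckij θ p u := by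
  have hp0 : (0 : ℝ) ≤ p := by linarith
  have h1 : (‖c‖ₑ ^ p) ^ (1 / p) = ‖c‖ₑ := by
    rw [← ENNReal.rpow_mul, mul_one_div_cancel (by linarith), ENNReal.rpow_one]
  unfold slobodeckij
  conv_rhs => rw [← h1]
  rw [← ENNReal.mul_rpow_of_nonneg _ _ (by positivity),
    ← lintegral_const_mul' _ _ (ENNReal.rpow_ne_top_of_nonneg hp0 enorm_ne_top)]
  refine le_of_eq ?_
  congr 2
  funext z
  simp only [Pi.smul_apply]
  rw [← smul_sub, enorm_smul, ENNReal.mul_rpow_of_nonneg _ _ hp0, mul_div_assoc]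

theorem sobolevENorm_congr (s p : ℝ) {u v : Rn n → ℝ} (h : u =ᵐ[volume] v) :
    sobolevENorm s p u = sobolevENorm s p v := by
  have h1 : ∀ ν, HasWeakDeriv ν u ↔ HasWeakDeriv ν v := fun ν =>
    ⟨fun ⟨w, hw⟩ => ⟨w, hw.congr h⟩, fun ⟨w, hw⟩ => ⟨w, hw.congr h.symm⟩⟩
  have h2 : ∀ ν, weakDeriv ν u =ᵐ[volume] weakDeriv ν v := by
    intro ν
    by_cases hν : HasWeakDeriv ν u
    · exact (hν.isWeakDeriv.congr h).weakDeriv_eq.symm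
    · rw [weakDeriv, weakDeriv, dif_neg hν, dif_neg (by rwa [← h1])]
  have h3 : (∀ m ≤ ⌊s⌋₊, ∀ ν ∈ multiIdx n m, HasWeakDeriv ν u) ↔
      ∀ m ≤ ⌊s⌋₊, ∀ ν ∈ multiIdx n m, HasWeakDeriv ν v := by simp only [h1]
  by_cases hu : ∀ m ≤ ⌊s⌋₊, ∀ ν ∈ multiIdx n m, HasWeakDeriv ν u
  · rw [sobolevENorm, sobolevENorm, if_pos hu, if_pos (h3.1 hu)]
    simp only [eLpNorm_congr_ae (h2 _), slobodeckij_congr _ _ (h2 _)]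
  · rw [sobolevENorm, sobolevENorm, if_neg hu, if_neg (mt h3.2 hu)]

theorem sobolevENorm_add_le (s : ℝ) {p : ℝ} (hp : 1 ≤ p) (u v : Rn n → ℝ) :
    sobolevENorm s p (u + v) ≤ sobolevENorm s p u + sobolevENorm s p v := by
  by_cases hu : ∀ m ≤ ⌊s⌋₊, ∀ ν ∈ multiIdx n m, HasWeakDeriv ν u
  swap
  · rw [sobolevENorm, sobolevENorm, if_neg hu]; simp
  by_cases hv : ∀ m ≤ ⌊s⌋₊, ∀ ν ∈ multiIdx n m, HasWeakDeriv ν v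
  swap
  · rw [sobolevENorm, sobolevENorm, sobolevENorm, if_neg hv]; simp
  have hw : ∀ m ≤ ⌊s⌋₊, ∀ ν ∈ multiIdx n m, IsWeakDeriv ν (u + v)
      (weakDeriv ν u + weakDeriv ν v) := fun m hm ν hν =>
    (hu m hm ν hν).isWeakDeriv.add (hv m hm ν hν).isWeakDeriv
  rw [sobolevENorm, sobolevENorm, sobolevENorm, if_pos hu, if_pos hv,
    if_pos fun m hm ν hν => ⟨_, hw m hm ν hν⟩, add_add_add_comm]
  refine add_le_add ?_ ?_
  · rw [← Finset.sum_add_distrib]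
    refine Finset.sum_le_sum fun m hm => ?_
    rw [← Finset.sum_add_distrib]
    refine Finset.sum_le_sum fun ν hν => ?_
    have hm' : m ≤ ⌊s⌋₊ := Nat.lt_succ_iff.1 (Finset.mem_range.1 hm)
    rw [eLpNorm_congr_ae (hw m hm' ν hν).weakDeriv_eq]
    exact eLpNorm_add_le (hu m hm' ν hν).isWeakDeriv.2.1.aestronglyMeasurable
      (hv m hm' ν hν).isWeakDeriv.2.1.aestronglyMeasurable (by simpa using hp)
  · split_ifs
    · simp
    rw [← Finset.sum_add_distrib]
    refine Finset.sum_le_sum fun ν hν => ?_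
    rw [slobodeckij_congr _ _ (hw _ le_rfl ν hν).weakDeriv_eq]
    exact slobodeckij_add_le _ hp (hu _ le_rfl ν hν).isWeakDeriv.2.1
      (hv _ le_rfl ν hν).isWeakDeriv.2.1

theorem multiIdx_zero : multiIdx n 0 = {0} := by
  simp [multiIdx]

theorem isWeakDeriv_zero_iff {u w : Rn n → ℝ} (h : IsWeakDeriv 0 u w) : u =ᵐ[volume] w := by
  have h' : ∀ φ : Rn n → ℝ, multiD 0 φ = φ := by
    intro φ
    unfold multiD
    induction List.finRange n with
    | nil => rfl
    | cons i l ih => exact ih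
  refine ae_eq_of_integral_contDiff_smul_eq h.1 h.2.1 fun φ hf hc => ?_
  simpa [h'] using h.2.2 φ hf hc

theorem eLpNorm_le_sobolevENorm (s p : ℝ) (u : Rn n → ℝ) :
    eLpNorm u (ENNReal.ofReal p) volume ≤ sobolevENorm s p u := by
  by_cases hu : ∀ m ≤ ⌊s⌋₊, ∀ ν ∈ multiIdx n m, HasWeakDeriv ν u
  swap
  · rw [sobolevENorm, if_neg hu]; exact le_top
  have h0 : u =ᵐ[volume] weakDeriv 0 u :=
    isWeakDeriv_zero_iff (hu 0 (Nat.zero_le _) 0 (by simp [multiIdx_zero])).isWeakDeriv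
  rw [sobolevENorm, if_pos hu, eLpNorm_congr_ae h0]
  refine le_trans ?_ le_self_add
  refine le_trans ?_ (Finset.single_le_sum (fun _ _ => zero_le)
    (Finset.mem_range.2 (Nat.succ_pos _) : 0 ∈ Finset.range (⌊s⌋₊ + 1)))
  rw [multiIdx_zero, Finset.sum_singleton]

theorem isWeakDeriv_fun_zero (ν : Fin n → ℕ) : IsWeakDeriv ν (0 : Rn n → ℝ) 0 :=
  ⟨locallyIntegrable_zero, locallyIntegrable_zero, fun φ _ _ => by simp⟩

theorem sobolevENorm_smul_le (s : ℝ) {p : ℝ} (hp : 1 ≤ p) (c : ℝ) (u : Rn n → ℝ) :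
    sobolevENorm s p (c • u) ≤ ‖c‖ₑ * sobolevENorm s p u := by
  by_cases hu : ∀ m ≤ ⌊s⌋₊, ∀ ν ∈ multiIdx n m, HasWeakDeriv ν u
  swap
  · rcases eq_or_ne c 0 with rfl | hc
    · have h0 : slobodeckij (n := n) (Int.fract s) p 0 = 0 := by
        have h := slobodeckij_smul_le (n := n) (Int.fract s) hp 0 0
        simpa using h
      have hz : ∀ ν : Fin n → ℕ, weakDeriv ν (0 : Rn n → ℝ) =ᵐ[volume] 0 := fun ν =>
        (isWeakDeriv_fun_zero ν).weakDeriv_eq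
      rw [zero_smul, sobolevENorm, if_pos fun m _ ν _ => ⟨_, isWeakDeriv_fun_zero ν⟩]
      simp [eLpNorm_congr_ae (hz _), slobodeckij_congr _ _ (hz _), h0]
    · rw [sobolevENorm, sobolevENorm, if_neg hu, ENNReal.mul_top (by simpa using hc)]
      exact le_top
  have hw : ∀ m ≤ ⌊s⌋₊, ∀ ν ∈ multiIdx n m, IsWeakDeriv ν (c • u) (c • weakDeriv ν u) :=
    fun m hm ν hν => (hu m hm ν hν).isWeakDeriv.smul c
  rw [sobolevENorm, sobolevENorm, if_pos hu, if_pos fun m hm ν hν => ⟨_, hw m hm ν hν⟩, mul_add]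
  refine add_le_add ?_ ?_
  · rw [Finset.mul_sum]
    refine Finset.sum_le_sum fun m hm => ?_
    rw [Finset.mul_sum]
    refine Finset.sum_le_sum fun ν hν => ?_
    have hm' : m ≤ ⌊s⌋₊ := Nat.lt_succ_iff.1 (Finset.mem_range.1 hm)
    rw [eLpNorm_congr_ae (hw m hm' ν hν).weakDeriv_eq, eLpNorm_const_smul]
  · split_ifs
    · simp
    rw [Finset.mul_sum]
    refine Finset.sum_le_sum fun ν hν => ?_
    rw [slobodeckij_congr _ _ (hw _ le_rfl ν hν).weakDeriv_eq]
    exact slobodeckij_smul_le _ hp c _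

end Lemmas

/-! ### The Sobolev-Slobodeckij spaces -/

/-- The norm of `W^{s,p}(ℝⁿ)` on classes of functions modulo equality almost everywhere. -/
def sobolevExtNorm (n : ℕ) (s p : ℝ) [hp : Fact (1 ≤ p)] :
    ExtNorm (Rn n →ₘ[volume] ℝ) where
  toFun u := sobolevENorm s p u
  eq_zero' u hu := by
    have h := le_antisymm ((eLpNorm_le_sobolevENorm s p u).trans hu.le) zero_le
    rw [eLpNorm_eq_zero_iff u.aestronglyMeasurable
      (by simpa using lt_of_lt_of_le one_pos hp.out)] at h
    exact AEEqFun.ext (h.trans AEEqFun.coeFn_zero.symm)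
  add_le' u v := by
    rw [sobolevENorm_congr s p (AEEqFun.coeFn_add u v)]
    exact sobolevENorm_add_le s hp.out _ _
  smul_le' c u := by
    rw [sobolevENorm_congr s p (AEEqFun.coeFn_smul c u)]
    exact sobolevENorm_smul_le s hp.out c _

/-- The normed space `W^{s,p}(ℝⁿ)` for real `s ≥ 0` and `1 ≤ p < ∞`. -/
abbrev SobolevSpace (n : ℕ) (s p : ℝ) [Fact (1 ≤ p)] :
    Submodule ℝ (Rn n →ₘ[volume] ℝ) :=
  (sobolevExtNorm n s p).finiteSubspace

/-- The norm of `W^{s,p}(Ω)`, where `W^{s,p}(Ω)` consists of the restrictions to `Ω` of the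
elements of `W^{s,p}(ℝⁿ)`: the infimum of the norms of the extensions `v` of `u` to `ℝⁿ`. -/
def sobolevExtNormOn {n : ℕ} (Ω : Set (Rn n)) (s p : ℝ) [hp : Fact (1 ≤ p)] :
    ExtNorm (Rn n →ₘ[volume.restrict Ω] ℝ) where
  toFun u := ⨅ v : {v : Rn n →ₘ[volume] ℝ // v =ᵐ[volume.restrict Ω] u}, sobolevENorm s p v.1
  eq_zero' u hu := by
    have h : eLpNorm u (ENNReal.ofReal p) (volume.restrict Ω) ≤ 0 := by
      rw [← hu]
      refine le_iInf fun v => ?_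
      rw [← eLpNorm_congr_ae v.2]
      exact (eLpNorm_mono_measure _ Measure.restrict_le_self).trans
        (eLpNorm_le_sobolevENorm s p _)
    have h' := le_antisymm h zero_le
    rw [eLpNorm_eq_zero_iff u.aestronglyMeasurable
      (by simpa using lt_of_lt_of_le one_pos hp.out)] at h'
    exact AEEqFun.ext (h'.trans AEEqFun.coeFn_zero.symm)
  add_le' u v := by
    refine ENNReal.le_iInf_add_iInf fun a b => ?_
    have hab : (a.1 + b.1 : Rn n →ₘ[volume] ℝ) =ᵐ[volume.restrict Ω] (u + v : _ →ₘ[_] ℝ) := by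
      filter_upwards [a.2, b.2, AEEqFun.coeFn_add u v,
        ae_restrict_of_ae (AEEqFun.coeFn_add a.1 b.1)] with x h1 h2 h3 h4
      rw [h3, h4, Pi.add_apply, Pi.add_apply, h1, h2]
    exact iInf_le_of_le ⟨a.1 + b.1, hab⟩ ((sobolevExtNorm n s p).add_le' a.1 b.1)
  smul_le' c u := by
    rcases eq_or_ne c 0 with rfl | hc
    · have hab : (0 : Rn n →ₘ[volume] ℝ) =ᵐ[volume.restrict Ω] ((0 : ℝ) • u : _ →ₘ[_] ℝ) := by
        filter_upwards [AEEqFun.coeFn_smul (0 : ℝ) u,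
          ae_restrict_of_ae (AEEqFun.coeFn_zero (α := Rn n) (μ := volume) (β := ℝ))] with x h1 h2
        rw [h1, h2]; simp
      exact (iInf_le _ ⟨_, hab⟩).trans
        (((sobolevExtNorm n s p).map_zero.le).trans zero_le)
    rw [ENNReal.mul_iInf_of_ne (by simpa using hc) enorm_ne_top]
    refine le_iInf fun a => ?_
    have hab : (c • a.1 : Rn n →ₘ[volume] ℝ) =ᵐ[volume.restrict Ω] (c • u : _ →ₘ[_] ℝ) := by
      filter_upwards [a.2, AEEqFun.coeFn_smul c u,
        ae_restrict_of_ae (AEEqFun.coeFn_smul c a.1)] with x h1 h2 h3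
      rw [h2, h3, Pi.smul_apply, Pi.smul_apply, h1]
    exact iInf_le_of_le ⟨c • a.1, hab⟩ ((sobolevExtNorm n s p).smul_le' c a.1)

/-- The normed space `W^{s,p}(Ω)` for real `s ≥ 0` and `1 ≤ p < ∞`. -/
abbrev SobolevSpaceOn {n : ℕ} (Ω : Set (Rn n)) (s p : ℝ) [Fact (1 ≤ p)] :
    Submodule ℝ (Rn n →ₘ[volume.restrict Ω] ℝ) :=
  (sobolevExtNormOn Ω s p).finiteSubspace

end

/-!
Pointwise multiplication `W^{s₁,p₁} × W^{s₂,p₂} → W^{s,p}` for integer `s`.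

By the Leibniz rule a derivative of order at most `s` of `u v` is a sum of products
`∂^α u ∂^β v` with `|α| + |β| ≤ s`. The factors have `s₁ - |α|` and `s₂ - |β|` derivatives left, and
the hypotheses are what Sobolev's embedding needs to put them into Lebesgue spaces `L^a` and `L^b`
with `1 / a + 1 / b = 1 / p`; the strict inequalities in the two alternatives avoid the borderline
embedding into `L^∞`, which fails in general (`exists_holder_exponents`,
`exists_holderTriple_bound`). Hölder's inequality then gives the estimate
`exists_sobolevENorm_mul_le` on `ℝⁿ`, and taking products of extensions carries it over to `Ω`
(`sobolevExtNormOn_mul_le`).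

The embeddings hold down to the exponent `q = 1`, the critical ones included, for elementary
reasons.

* Fractional order, finite target (`eLpNorm_le_slobodeckij`). With
  `F x = ∫ |u x - u y|^q / |x - y|^(n + θ q) dy`, comparing `u x` with its average over the ball of
  radius `R ≤ 1` gives `|u x| ≤ K (R^θ F(x)^{1/q} + R^{-n/m} ‖u‖_m)`. Optimizing `R` pointwise and
  integrating gives `‖u‖_m^m ≤ K' ‖u‖_m^{m-q} (‖u‖_q^q + [u]^q)`, in which the unknown norm can be
  divided out as soon as it is finite; truncation takes care of the finiteness.
* Fractional order, bounded target (`eLpNorm_top_le_slobodeckij`). The averages over balls of radii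
  `2^{-j}` form a telescoping series dominated by a geometric one, and converge almost everywhere to
  the function.
* First order. `W^{1,q} ⊆ W^{θ,q}` for `θ < 1` (`slobodeckij_le_of_isWeakPartial`) covers everything
  but the critical exponent, for which the Gagliardo-Nirenberg-Sobolev inequality of Mathlib is
  extended from compactly supported smooth functions by mollification and cut-off
  (`eLpNorm_le_of_isWeakPartial`).

Higher orders follow by iteration. The product rule for weak derivatives (`IsWeakPartial.mul`) is
proved by mollifying one factor; to pass to the limit one uses that the mollified products converge
at all Hölder exponents (`tendsto_integral_moll_mul`).
-/

noncomputable section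

/-! ### Fractional Sobolev embeddings -/

theorem lintegral_rpow_le_of_isProbabilityMeasure {α : Type*} [MeasurableSpace α] {μ : Measure α}
    [IsProbabilityMeasure μ] {q : ℝ} (hq : 1 ≤ q) {g : α → ℝ≥0∞} (hg : AEMeasurable g μ) :
    (∫⁻ x, g x ∂μ) ^ q ≤ ∫⁻ x, g x ^ q ∂μ := by
  have hq0 : 0 < q := by linarith
  have h := eLpNorm_le_eLpNorm_of_exponent_le (μ := μ) (p := 1) (q := ENNReal.ofReal q)
    (by simpa using hq) hg.aestronglyMeasurable
  rw [eLpNorm_one_eq_lintegral_enorm, eLpNorm_eq_lintegral_rpow_enorm_toReal (by simpa using hq0)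
    (by simp), ENNReal.toReal_ofReal hq0.le] at h
  simp only [enorm_eq_self] at h
  calc _ ≤ ((∫⁻ x, g x ^ q ∂μ) ^ (1 / q)) ^ q := ENNReal.rpow_le_rpow h hq0.le
    _ = _ := by rw [← ENNReal.rpow_mul, one_div_mul_cancel hq0.ne', ENNReal.rpow_one]

theorem eLpNorm_ofReal_eq {α : Type*} [MeasurableSpace α] {μ : Measure α} {q : ℝ} (hq : 0 < q)
    (f : α → ℝ) : eLpNorm f (ENNReal.ofReal q) μ = (∫⁻ x, ‖f x‖ₑ ^ q ∂μ) ^ (1 / q) := by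
  rw [eLpNorm_eq_lintegral_rpow_enorm_toReal (by simpa using hq) (by simp),
    ENNReal.toReal_ofReal hq.le]

theorem eLpNorm_ofReal_rpow {α : Type*} [MeasurableSpace α] {μ : Measure α} {q : ℝ} (hq : 0 < q)
    (f : α → ℝ) : eLpNorm f (ENNReal.ofReal q) μ ^ q = ∫⁻ x, ‖f x‖ₑ ^ q ∂μ := by
  rw [eLpNorm_ofReal_eq hq, ← ENNReal.rpow_mul, one_div_mul_cancel hq.ne', ENNReal.rpow_one]

variable {n : ℕ}

theorem aemeasurable_slobodeckij_kernel {u : Rn n → ℝ} (hu : AEStronglyMeasurable u) (q e : ℝ) :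
    AEMeasurable (fun z : Rn n × Rn n => ‖u z.1 - u z.2‖ₑ ^ q / ‖z.1 - z.2‖ₑ ^ e) volume := by
  have h1 : AEMeasurable (fun z : Rn n × Rn n => u z.1 - u z.2) volume :=
    (hu.comp_fst.sub hu.comp_snd).aemeasurable
  exact (h1.enorm.pow_const _).div
    (((measurable_fst.sub measurable_snd).enorm).pow_const _).aemeasurable

theorem slobodeckij_rpow (θ : ℝ) {q : ℝ} (hq : 0 < q) (u : Rn n → ℝ) :
    slobodeckij θ q u ^ q =
      ∫⁻ z : Rn n × Rn n, ‖u z.1 - u z.2‖ₑ ^ q / ‖z.1 - z.2‖ₑ ^ ((n : ℝ) + θ * q) := by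
  rw [slobodeckij, ← ENNReal.rpow_mul, one_div_mul_cancel hq.ne', ENNReal.rpow_one]

theorem slobodeckij_rpow_eq_lintegral (θ : ℝ) {q : ℝ} (hq : 0 < q) {u : Rn n → ℝ}
    (hu : AEStronglyMeasurable u) : slobodeckij θ q u ^ q =
      ∫⁻ x, ∫⁻ y, ‖u x - u y‖ₑ ^ q / ‖x - y‖ₑ ^ ((n : ℝ) + θ * q) := by
  rw [slobodeckij_rpow θ hq]
  exact lintegral_prod _ (aemeasurable_slobodeckij_kernel hu q _)

/-- On the set `‖x - y‖ ≤ r` the kernel of the Slobodeckij seminorm dominates the increments. -/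
theorem enorm_sub_rpow_le_kernel {q e : ℝ} (hq : 0 < q) (he : 0 ≤ e) (u : Rn n → ℝ) {x y : Rn n}
    {R : ℝ≥0∞} (h : ‖x - y‖ₑ ≤ R) :
    ‖u x - u y‖ₑ ^ q ≤ R ^ e * (‖u x - u y‖ₑ ^ q / ‖x - y‖ₑ ^ e) := by
  -- on the diagonal the kernel takes the junk value `0 / 0 = 0`, which is harmless here
  rcases eq_or_ne x y with rfl | hxy
  · simp [hq]
  have h0 : ‖x - y‖ₑ ≠ 0 := by simpa [sub_eq_zero] using hxy
  have h1 : ‖x - y‖ₑ ^ e ≠ 0 := by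
    rw [Ne, ENNReal.rpow_eq_zero_iff]; simp [h0]
  have h2 : ‖x - y‖ₑ ^ e ≠ ⊤ := ENNReal.rpow_ne_top_of_nonneg he enorm_ne_top
  calc ‖u x - u y‖ₑ ^ q = ‖x - y‖ₑ ^ e * (‖u x - u y‖ₑ ^ q / ‖x - y‖ₑ ^ e) := by
        rw [ENNReal.mul_div_cancel h1 h2]
    _ ≤ _ := by gcongr

theorem volume_closedBall_eq (x : Rn n) {r : ℝ} (hr : 0 ≤ r) :
    volume (Metric.closedBall x r) =
      ENNReal.ofReal r ^ (n : ℝ) * volume (Metric.ball (0 : Rn n) 1) := by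
  rw [Measure.addHaar_closedBall _ _ hr]
  simp [ENNReal.ofReal_pow hr]

/-- The average of `u` over a small ball controls `u x` up to the local Slobodeckij energy. -/
theorem enorm_le_energy_add {θ q m : ℝ} (hθ : 0 ≤ θ) (hq : 1 ≤ q) (hm : 1 ≤ m)
    {u : Rn n → ℝ} (hu : AEStronglyMeasurable u) (x : Rn n) {r : ℝ} (hr : 0 < r) :
    ‖u x‖ₑ ≤ (volume (Metric.ball (0 : Rn n) 1))⁻¹ ^ (1 / q) * (ENNReal.ofReal r ^ θ *
        (∫⁻ y, ‖u x - u y‖ₑ ^ q / ‖x - y‖ₑ ^ ((n : ℝ) + θ * q)) ^ (1 / q)) +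
      (volume (Metric.ball (0 : Rn n) 1))⁻¹ ^ (1 / m) * (ENNReal.ofReal r ^ (-(n / m)) *
        eLpNorm u (ENNReal.ofReal m) volume) := by
  have hq0 : 0 < q := by linarith
  have hm0 : 0 < m := by linarith
  set R := ENNReal.ofReal r with hR
  set κ := volume (Metric.ball (0 : Rn n) 1) with hκ
  have hR0 : R ≠ 0 := by simpa [hR] using hr
  have hRt : R ≠ ⊤ := by simp [hR]
  have hκ0 : κ ≠ 0 := (Metric.measure_ball_pos _ _ one_pos).ne'
  have hκt : κ ≠ ⊤ := measure_ball_lt_top.ne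
  set B := Metric.closedBall x r with hB
  have hv : volume B = R ^ (n : ℝ) * κ := volume_closedBall_eq x hr.le
  have hRn0 : R ^ (n : ℝ) ≠ 0 := by simp [hR0]
  have hRnt : R ^ (n : ℝ) ≠ ⊤ := ENNReal.rpow_ne_top_of_nonneg (by positivity) hRt
  have hv0 : volume B ≠ 0 := by rw [hv]; exact mul_ne_zero hRn0 hκ0
  have hvt : volume B ≠ ⊤ := by rw [hv]; exact ENNReal.mul_ne_top hRnt hκt
  have hinv : (volume B)⁻¹ = R ^ (-(n : ℝ)) * κ⁻¹ := by
    rw [hv, ENNReal.mul_inv (Or.inl hRn0) (Or.inl hRnt), ENNReal.rpow_neg]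
  set μ : Measure (Rn n) := (volume B)⁻¹ • volume.restrict B with hμ
  have : IsProbabilityMeasure μ := ⟨by
    simp [hμ, ENNReal.inv_mul_cancel hv0 hvt]⟩
  have hac : μ ≪ volume :=
    Measure.smul_absolutelyContinuous.trans Measure.restrict_le_self.absolutelyContinuous
  have hum : AEStronglyMeasurable u μ := hu.mono_ac hac
  have hdm : AEMeasurable (fun y => ‖u x - u y‖ₑ) μ :=
    (aestronglyMeasurable_const.sub hum).aemeasurable.enorm
  have h1 : ∫⁻ y, ‖u x - u y‖ₑ ^ q ∂μ ≤ κ⁻¹ * (R ^ (θ * q) *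
      ∫⁻ y, ‖u x - u y‖ₑ ^ q / ‖x - y‖ₑ ^ ((n : ℝ) + θ * q)) := by
    rw [hμ, lintegral_smul_measure, hinv]
    have : ∫⁻ y in B, ‖u x - u y‖ₑ ^ q ≤ R ^ ((n : ℝ) + θ * q) *
        ∫⁻ y, ‖u x - u y‖ₑ ^ q / ‖x - y‖ₑ ^ ((n : ℝ) + θ * q) := by
      rw [← lintegral_const_mul' _ _ (ENNReal.rpow_ne_top_of_nonneg (by positivity) hRt)]
      refine le_trans ?_ (setLIntegral_le_lintegral B _)
      refine setLIntegral_mono' Metric.isClosed_closedBall.measurableSet fun y hy => ?_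
      refine enorm_sub_rpow_le_kernel hq0 (by positivity) u ?_
      rw [← ofReal_norm]
      refine ENNReal.ofReal_le_ofReal ?_
      rw [← dist_eq_norm, dist_comm]; exact hy
    rw [smul_eq_mul]
    refine (mul_le_mul' le_rfl this).trans_eq ?_
    rw [mul_comm (R ^ (-(n : ℝ))), mul_assoc, ← mul_assoc (R ^ (-(n : ℝ))),
      ← ENNReal.rpow_add _ _ hR0 hRt, neg_add_cancel_left]
  have h2 : ∫⁻ y, ‖u y‖ₑ ^ m ∂μ ≤ R ^ (-(n : ℝ)) * κ⁻¹ * ∫⁻ y, ‖u y‖ₑ ^ m := by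
    rw [hμ, lintegral_smul_measure, hinv, smul_eq_mul]
    exact mul_le_mul' le_rfl (setLIntegral_le_lintegral B _)
  have key : ∀ (c : ℝ) (g : Rn n → ℝ≥0∞), 1 ≤ c → AEMeasurable g μ →
      ∫⁻ y, g y ∂μ ≤ (∫⁻ y, g y ^ c ∂μ) ^ (1 / c) := by
    intro c g hc hg
    rw [one_div, ENNReal.le_rpow_inv_iff (by linarith)]
    exact lintegral_rpow_le_of_isProbabilityMeasure hc hg
  calc ‖u x‖ₑ = ∫⁻ _, ‖u x‖ₑ ∂μ := by simp
    _ ≤ ∫⁻ y, (‖u x - u y‖ₑ + ‖u y‖ₑ) ∂μ := by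
        refine lintegral_mono fun y => ?_
        calc ‖u x‖ₑ = ‖(u x - u y) + u y‖ₑ := by simp
          _ ≤ _ := enorm_add_le _ _
    _ = ∫⁻ y, ‖u x - u y‖ₑ ∂μ + ∫⁻ y, ‖u y‖ₑ ∂μ := lintegral_add_left' hdm _
    _ ≤ (κ⁻¹ * (R ^ (θ * q) * ∫⁻ y, ‖u x - u y‖ₑ ^ q / ‖x - y‖ₑ ^ ((n : ℝ) + θ * q))) ^ (1 / q)
        + (R ^ (-(n : ℝ)) * κ⁻¹ * ∫⁻ y, ‖u y‖ₑ ^ m) ^ (1 / m) := by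
        refine add_le_add ((key q _ hq hdm).trans ?_) ((key m _ hm hum.aemeasurable.enorm).trans ?_)
        · exact ENNReal.rpow_le_rpow h1 (by positivity)
        · exact ENNReal.rpow_le_rpow h2 (by positivity)
    _ = _ := by
        rw [eLpNorm_ofReal_eq hm0]
        simp only [ENNReal.mul_rpow_of_nonneg _ _ (by positivity : 0 ≤ 1 / q),
          ENNReal.mul_rpow_of_nonneg _ _ (by positivity : 0 ≤ 1 / m), ← ENNReal.rpow_mul R]
        rw [mul_assoc θ, mul_one_div_cancel hq0.ne', mul_one]
        congr 1
        rw [show -(n : ℝ) * (1 / m) = -(n / m) by ring]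
        ring

/-- The choice `R = (b / a) ^ (q / n)` of the radius, capped at `1`, in the previous bound. -/
theorem rpow_le_of_forall_radius (hn : 0 < n) {θ q m : ℝ} (hq : 1 ≤ q) (hqm : q ≤ m)
    (hm : 1 / q - θ / n ≤ 1 / m) {t K a b : ℝ≥0∞} (hK : 1 ≤ K) (hb0 : b ≠ 0)
    (hbt : b ≠ ⊤)
    (h : ∀ r : ℝ, 0 < r → t ≤ K * (ENNReal.ofReal r ^ θ * a + ENNReal.ofReal r ^ (-(n / m)) * b)) :
    t ^ m ≤ (2 * K) ^ m * b ^ (m - q) * (a ^ q + t ^ q) := by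
  have hn' : (0 : ℝ) < n := by exact_mod_cast hn
  have hq0 : 0 < q := by linarith
  have hm0 : 0 < m := by linarith
  have hK2 : (1 : ℝ≥0∞) ≤ 2 * K := by
    calc (1 : ℝ≥0∞) ≤ 2 * 1 := by norm_num
      _ ≤ _ := by gcongr
  rcases lt_or_ge a b with hab | hab
  · -- the radius `1`
    have h1 : t ≤ 2 * K * b := by
      have := h 1 one_pos
      simp only [ENNReal.ofReal_one, ENNReal.one_rpow, one_mul] at this
      calc t ≤ K * (a + b) := this
        _ ≤ K * (b + b) := by gcongr
        _ = _ := by ring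
    rcases eq_or_ne t 0 with rfl | ht
    · simp [hm0]
    rcases eq_or_ne t ⊤ with rfl | ht'
    · have : K = ⊤ := by
        by_contra hK'
        exact absurd (top_le_iff.1 h1) (ENNReal.mul_ne_top (ENNReal.mul_ne_top (by simp) hK') hbt)
      subst this
      have : b ^ (m - q) ≠ 0 := by
        rw [Ne, ENNReal.rpow_eq_zero_iff]; simp [hb0, hbt]
      simp [hm0, hq0, ENNReal.top_mul, this]
    calc t ^ m = t ^ (m - q) * t ^ q := by
          rw [← ENNReal.rpow_add _ _ ht ht']; ring_nf
      _ ≤ (2 * K * b) ^ (m - q) * t ^ q := by gcongr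
      _ = (2 * K) ^ (m - q) * b ^ (m - q) * t ^ q := by
          rw [ENNReal.mul_rpow_of_nonneg _ _ (by linarith : 0 ≤ m - q)]
      _ ≤ (2 * K) ^ m * b ^ (m - q) * (a ^ q + t ^ q) :=
          mul_le_mul' (mul_le_mul' (ENNReal.rpow_le_rpow_of_exponent_le hK2 (by linarith)) le_rfl)
            le_add_self
  · rcases eq_or_ne a ⊤ with rfl | hat
    · have h1 : b ^ (m - q) ≠ 0 := by
        rw [Ne, ENNReal.rpow_eq_zero_iff]; simp [hb0, hbt]
      have h2 : (2 * K) ^ m ≠ 0 := by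
        rw [Ne, ENNReal.rpow_eq_zero_iff]; simp [(one_pos.trans_le hK2).ne', hm0.le]
      simp [hq0, ENNReal.mul_top (mul_ne_zero h2 h1)]
    have ha0 : a ≠ 0 := fun h0 => hb0 (le_antisymm (h0 ▸ hab) zero_le)
    set R : ℝ≥0∞ := (b / a) ^ (q / n) with hR
    have hba0 : b / a ≠ 0 := (ENNReal.div_pos hb0 hat).ne'
    have hbat : b / a ≠ ⊤ := ENNReal.div_ne_top hbt ha0
    have hR0 : R ≠ 0 := by rw [hR, Ne, ENNReal.rpow_eq_zero_iff]; simp [hba0, hbat]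
    have hRt : R ≠ ⊤ := ENNReal.rpow_ne_top_of_nonneg (by positivity) hbat
    have hR1 : R ≤ 1 := by
      refine ENNReal.rpow_le_one ?_ (by positivity)
      exact ENNReal.div_le_of_le_mul (by simpa using hab)
    have h1 := h R.toReal (ENNReal.toReal_pos hR0 hRt)
    rw [ENNReal.ofReal_toReal hRt] at h1
    have hexp : q / n * (n * (1 / q - 1 / m)) = 1 - q / m := by field_simp
    have e1 : R ^ θ * a ≤ a ^ (q / m) * b ^ (1 - q / m) := by
      have h2 : R ^ θ ≤ R ^ (n * (1 / q - 1 / m)) := by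
        refine ENNReal.rpow_le_rpow_of_exponent_ge hR1 ?_
        have : n * (1 / q - 1 / m) ≤ n * (θ / n) := by gcongr; linarith
        rwa [mul_div_cancel₀ _ hn'.ne'] at this
      calc R ^ θ * a ≤ R ^ (n * (1 / q - 1 / m)) * a := by gcongr
        _ = (b / a) ^ (1 - q / m) * a := by rw [hR, ← ENNReal.rpow_mul, hexp]
        _ = (b ^ (1 - q / m) * a ^ (-(1 - q / m))) * a ^ (1 : ℝ) := by
            rw [ENNReal.div_eq_inv_mul, ENNReal.mul_rpow_of_ne_top (by simp [ha0]) hbt,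
              ENNReal.rpow_neg, ENNReal.inv_rpow, ENNReal.rpow_one, mul_comm (_⁻¹)]
        _ = _ := by
            rw [mul_assoc, ← ENNReal.rpow_add _ _ ha0 hat, mul_comm]
            ring_nf
    have e2 : R ^ (-(n / m)) * b = a ^ (q / m) * b ^ (1 - q / m) := by
      rw [hR, ← ENNReal.rpow_mul, show q / n * -(n / m) = -(q / m) by field_simp,
        ENNReal.rpow_neg, ← ENNReal.inv_rpow, ENNReal.inv_div (Or.inl hat) (Or.inl ha0),
        ENNReal.div_eq_inv_mul, ENNReal.mul_rpow_of_ne_top (by simp [hb0]) hat,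
        ENNReal.inv_rpow, ← ENNReal.rpow_neg]
      conv_lhs => rw [← ENNReal.rpow_one b, ← ENNReal.rpow_mul, one_mul]
      rw [mul_comm (b ^ (-(q / m))), mul_assoc, ← ENNReal.rpow_add _ _ hb0 hbt]
      ring_nf
    have h3 : t ≤ 2 * K * (a ^ (q / m) * b ^ (1 - q / m)) := by
      calc t ≤ _ := h1
        _ ≤ K * (a ^ (q / m) * b ^ (1 - q / m) + a ^ (q / m) * b ^ (1 - q / m)) := by
            rw [e2]; gcongr
        _ = _ := by ring
    calc t ^ m ≤ (2 * K * (a ^ (q / m) * b ^ (1 - q / m))) ^ m := by gcongr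
      _ = (2 * K) ^ m * b ^ (m - q) * a ^ q := by
          rw [ENNReal.mul_rpow_of_nonneg _ (_ * _) hm0.le,
            ENNReal.mul_rpow_of_nonneg (a ^ _) _ hm0.le,
            ← ENNReal.rpow_mul, ← ENNReal.rpow_mul, div_mul_cancel₀ _ hm0.ne',
            show (1 - q / m) * m = m - q by field_simp]
          ring
      _ ≤ _ := by gcongr; exact le_self_add

/-- The fractional Sobolev inequality for functions already known to lie in the target space. -/
theorem eLpNorm_le_slobodeckij_of_ne_top (hn : 0 < n) {θ q m : ℝ} (hθ : 0 ≤ θ) (hq : 1 ≤ q)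
    (hqm : q ≤ m) (hm : 1 / q - θ / n ≤ 1 / m) : ∃ C : ℝ≥0∞, C ≠ ⊤ ∧ ∀ u : Rn n → ℝ,
      AEStronglyMeasurable u → eLpNorm u (ENNReal.ofReal m) volume ≠ ⊤ →
      eLpNorm u (ENNReal.ofReal m) volume ≤
        C * (eLpNorm u (ENNReal.ofReal q) volume + slobodeckij θ q u) := by
  have hq0 : 0 < q := by linarith
  have hm0 : 0 < m := by linarith
  set κ := volume (Metric.ball (0 : Rn n) 1) with hκ
  have hκ0 : κ ≠ 0 := (Metric.measure_ball_pos _ _ one_pos).ne'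
  set K : ℝ≥0∞ := κ⁻¹ ^ (1 / q) + κ⁻¹ ^ (1 / m) + 1 with hK
  have hKt : K ≠ ⊤ := by
    simp only [hK, Ne, ENNReal.add_eq_top, not_or]
    exact ⟨⟨ENNReal.rpow_ne_top_of_nonneg (by positivity) (by simp [hκ0]),
      ENNReal.rpow_ne_top_of_nonneg (by positivity) (by simp [hκ0])⟩, by simp⟩
  have hK1 : 1 ≤ K := le_add_self
  refine ⟨(2 * K) ^ (m / q), ENNReal.rpow_ne_top_of_nonneg (by positivity)
    (ENNReal.mul_ne_top (by simp) hKt), fun u hu hbt => ?_⟩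
  set b := eLpNorm u (ENNReal.ofReal m) volume with hb
  rcases eq_or_ne b 0 with hb0 | hb0
  · rw [hb0]; exact zero_le
  set F : Rn n → ℝ≥0∞ := fun x => ∫⁻ y, ‖u x - u y‖ₑ ^ q / ‖x - y‖ₑ ^ ((n : ℝ) + θ * q) with hF
  have hpt : ∀ x, ‖u x‖ₑ ^ m ≤ (2 * K) ^ m * b ^ (m - q) * (F x + ‖u x‖ₑ ^ q) := by
    intro x
    have := rpow_le_of_forall_radius hn (t := ‖u x‖ₑ) (a := F x ^ (1 / q)) hq hqm hm hK1 hb0 hbt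
      fun r hr => (enorm_le_energy_add hθ hq (hq.trans hqm) hu x hr).trans (by
        rw [mul_add]
        gcongr
        · exact (le_self_add).trans le_self_add
        · exact (le_add_self).trans le_self_add)
    rwa [← ENNReal.rpow_mul, one_div_mul_cancel hq0.ne', ENNReal.rpow_one] at this
  have hcoef : (2 * K) ^ m * b ^ (m - q) ≠ ⊤ :=
    ENNReal.mul_ne_top (ENNReal.rpow_ne_top_of_nonneg hm0.le (ENNReal.mul_ne_top (by simp) hKt))
      (ENNReal.rpow_ne_top_of_nonneg (by linarith) hbt)
  have hint : b ^ m ≤ (2 * K) ^ m * b ^ (m - q) *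
      (slobodeckij θ q u ^ q + eLpNorm u (ENNReal.ofReal q) volume ^ q) := by
    rw [hb, eLpNorm_ofReal_rpow hm0, slobodeckij_rpow_eq_lintegral θ hq0 hu,
      eLpNorm_ofReal_rpow hq0, ← lintegral_add_right' _ (hu.aemeasurable.enorm.pow_const _),
      ← lintegral_const_mul' _ _ hcoef]
    exact lintegral_mono hpt
  have hbm0 : b ^ (m - q) ≠ 0 := by
    rw [Ne, ENNReal.rpow_eq_zero_iff]; simp [hb0, hbt]
  have hbmt : b ^ (m - q) ≠ ⊤ := ENNReal.rpow_ne_top_of_nonneg (by linarith) hbt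
  have hbq : b ^ q ≤ (2 * K) ^ m *
      (slobodeckij θ q u ^ q + eLpNorm u (ENNReal.ofReal q) volume ^ q) := by
    refine (ENNReal.mul_le_mul_iff_right hbm0 hbmt).1 ?_
    calc b ^ (m - q) * b ^ q = b ^ m := by
          rw [← ENNReal.rpow_add _ _ hb0 hbt]; ring_nf
      _ ≤ _ := hint
      _ = _ := by ring
  calc b = (b ^ q) ^ (1 / q) := by
        rw [← ENNReal.rpow_mul, mul_one_div_cancel hq0.ne', ENNReal.rpow_one]
    _ ≤ ((2 * K) ^ m *
      (slobodeckij θ q u ^ q + eLpNorm u (ENNReal.ofReal q) volume ^ q)) ^ (1 / q) := by gcongr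
    _ = (2 * K) ^ (m / q) *
      (slobodeckij θ q u ^ q + eLpNorm u (ENNReal.ofReal q) volume ^ q) ^ (1 / q) := by
        rw [ENNReal.mul_rpow_of_nonneg _ _ (by positivity), ← ENNReal.rpow_mul, mul_one_div]
    _ ≤ _ := by
        gcongr
        rw [add_comm (eLpNorm u _ _)]
        exact ENNReal.rpow_add_rpow_le_add _ _ hq

/-- The fractional Sobolev embedding `W^{θ,q} ⊆ L^m` for finite `m`, the critical exponent
included: truncation reduces it to functions that already lie in `L^m`. -/
theorem eLpNorm_le_slobodeckij (hn : 0 < n) {θ q m : ℝ} (hθ : 0 ≤ θ) (hq : 1 ≤ q)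
    (hqm : q ≤ m) (hm : 1 / q - θ / n ≤ 1 / m) : ∃ C : ℝ≥0∞, C ≠ ⊤ ∧ ∀ u : Rn n → ℝ,
      AEStronglyMeasurable u → eLpNorm u (ENNReal.ofReal q) volume ≠ ⊤ →
      eLpNorm u (ENNReal.ofReal m) volume ≤
        C * (eLpNorm u (ENNReal.ofReal q) volume + slobodeckij θ q u) := by
  have hq0 : 0 < q := by linarith
  have hm0 : 0 < m := by linarith
  obtain ⟨C, hC, h⟩ := eLpNorm_le_slobodeckij_of_ne_top hn hθ hq hqm hm
  refine ⟨C, hC, fun u hu huq => ?_⟩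
  set T : ℕ → ℝ → ℝ := fun M t => max (-(M : ℝ)) (min M t) with hT
  have hTc : ∀ M, Continuous (T M) := fun M => by simp only [hT]; fun_prop
  have hTlip : ∀ M s t, |T M s - T M t| ≤ |s - t| := by
    intro M s t
    simp only [hT]
    refine (abs_max_sub_max_le_max _ _ _ _).trans (max_le (by simp) ?_)
    exact (abs_min_sub_min_le_max _ _ _ _).trans (max_le (by simp) le_rfl)
  have hT0 : ∀ M, T M 0 = 0 := by intro M; simp [hT]
  have hTle : ∀ M t, |T M t| ≤ |t| := fun M t => by simpa [hT0] using hTlip M t 0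
  have hTM : ∀ M t, |T M t| ≤ M := by
    intro M t
    simp only [hT, abs_le]
    have : (0 : ℝ) ≤ M := by positivity
    exact ⟨le_max_left _ _, max_le (by linarith) (min_le_left _ _)⟩
  have hTlim : ∀ t, Tendsto (fun M => T M t) atTop (nhds t) := by
    intro t
    refine tendsto_const_nhds.congr' ?_
    filter_upwards [eventually_ge_atTop ⌈|t|⌉₊] with M hM
    have h1 : |t| ≤ M := (Nat.le_ceil _).trans (by exact_mod_cast hM)
    rw [abs_le] at h1
    simp [hT, h1.1, h1.2]
  have hmeas : ∀ M, AEStronglyMeasurable (fun x => T M (u x)) volume := fun M =>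
    (hTc M).comp_aestronglyMeasurable hu
  refine Lp.eLpNorm_le_of_ae_tendsto (u := atTop) (f := fun M x => T M (u x))
    (Eventually.of_forall fun M => ?_) hmeas (Eventually.of_forall fun x => hTlim _)
  have hTe : ∀ M s t, ‖T M s - T M t‖ₑ ≤ ‖s - t‖ₑ := fun M s t => by
    rw [← ofReal_norm, ← ofReal_norm]
    exact ENNReal.ofReal_le_ofReal (hTlip M s t)
  have hle : eLpNorm (fun x => T M (u x)) (ENNReal.ofReal q) volume ≤
      eLpNorm u (ENNReal.ofReal q) volume := eLpNorm_mono fun x => hTle M (u x)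
  refine (h _ (hmeas M) ?_).trans ?_
  · have h1 : ∫⁻ x, ‖T M (u x)‖ₑ ^ m ≤ (M : ℝ≥0∞) ^ (m - q) *
        eLpNorm u (ENNReal.ofReal q) volume ^ q := by
      rw [eLpNorm_ofReal_rpow hq0, ← lintegral_const_mul' _ _
        (ENNReal.rpow_ne_top_of_nonneg (by linarith) (by simp))]
      refine lintegral_mono fun x => ?_
      have h2 : ‖T M (u x)‖ₑ ≤ M := by
        rw [← ofReal_norm, ← ENNReal.ofReal_natCast]
        exact ENNReal.ofReal_le_ofReal (hTM M (u x))
      have h3 : ‖T M (u x)‖ₑ ≤ ‖u x‖ₑ := by simpa [hT0] using hTe M (u x) 0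
      calc ‖T M (u x)‖ₑ ^ m = ‖T M (u x)‖ₑ ^ ((m - q) + q) := by ring_nf
        _ = ‖T M (u x)‖ₑ ^ (m - q) * ‖T M (u x)‖ₑ ^ q :=
            ENNReal.rpow_add_of_nonneg _ _ (by linarith) hq0.le
        _ ≤ _ := by gcongr
    rw [eLpNorm_ofReal_eq hm0]
    refine ENNReal.rpow_ne_top_of_nonneg (by positivity) (ne_top_of_le_ne_top ?_ h1)
    exact ENNReal.mul_ne_top (ENNReal.rpow_ne_top_of_nonneg (by linarith) (by simp))
      (ENNReal.rpow_ne_top_of_nonneg hq0.le huq)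
  · gcongr
    unfold slobodeckij
    gcongr
    exact hTe M _ _

/-- The averages of `u` over two concentric balls of radii `2 r` and `r` differ by at most
`C r ^ (θ - n / q)` times the Slobodeckij seminorm. -/
theorem enorm_average_sub_average_le {θ q : ℝ} (hθ : 0 ≤ θ) (hq : 1 ≤ q)
    {u : Rn n → ℝ} (hu : LocallyIntegrable u) (x : Rn n) {r : ℝ} (hr : 0 < r) :
    ‖(⨍ y in Metric.closedBall x (2 * r), u y) - ⨍ y in Metric.closedBall x r, u y‖ₑ ≤
      ((volume (Metric.ball (0 : Rn n) 1))⁻¹ * (volume (Metric.ball (0 : Rn n) 1))⁻¹ *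
        (2 ^ (-(n : ℝ)) * 4 ^ ((n : ℝ) + θ * q))) ^ (1 / q) *
        ENNReal.ofReal r ^ (θ - n / q) * slobodeckij θ q u := by
  have hq0 : 0 < q := by linarith
  set κ := volume (Metric.ball (0 : Rn n) 1) with hκ
  set S := ENNReal.ofReal r with hS
  have hS0 : S ≠ 0 := by simpa [hS] using hr
  have hSt : S ≠ ⊤ := by simp [hS]
  have hκ0 : κ ≠ 0 := (Metric.measure_ball_pos _ _ one_pos).ne'
  have hκt : κ ≠ ⊤ := measure_ball_lt_top.ne
  set B := Metric.closedBall x (2 * r) with hB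
  set B' := Metric.closedBall x r with hB'
  have hSn0 : S ^ (n : ℝ) ≠ 0 := by simp [hS0]
  have hSnt : S ^ (n : ℝ) ≠ ⊤ := ENNReal.rpow_ne_top_of_nonneg (by positivity) hSt
  have h2n0 : (2 : ℝ≥0∞) ^ (n : ℝ) ≠ 0 := by simp
  have h2nt : (2 : ℝ≥0∞) ^ (n : ℝ) ≠ ⊤ := by simp
  have hv' : volume B' = S ^ (n : ℝ) * κ := volume_closedBall_eq x hr.le
  have hv : volume B = 2 ^ (n : ℝ) * S ^ (n : ℝ) * κ := by
    rw [hB, volume_closedBall_eq x (by positivity), ENNReal.ofReal_mul (by norm_num),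
      ENNReal.mul_rpow_of_nonneg _ _ (by positivity)]
    simp [hS, hκ]
  have hv0 : volume B ≠ 0 := by rw [hv]; exact mul_ne_zero (mul_ne_zero h2n0 hSn0) hκ0
  have hvt : volume B ≠ ⊤ := by
    rw [hv]; exact ENNReal.mul_ne_top (ENNReal.mul_ne_top h2nt hSnt) hκt
  have hv0' : volume B' ≠ 0 := by rw [hv']; exact mul_ne_zero hSn0 hκ0
  have hvt' : volume B' ≠ ⊤ := by rw [hv']; exact ENNReal.mul_ne_top hSnt hκt
  have hinv' : (volume B')⁻¹ = S ^ (-(n : ℝ)) * κ⁻¹ := by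
    rw [hv', ENNReal.mul_inv (Or.inl hSn0) (Or.inl hSnt), ENNReal.rpow_neg]
  have hinv : (volume B)⁻¹ = 2 ^ (-(n : ℝ)) * S ^ (-(n : ℝ)) * κ⁻¹ := by
    rw [hv, ENNReal.mul_inv (Or.inl (mul_ne_zero h2n0 hSn0))
      (Or.inl (ENNReal.mul_ne_top h2nt hSnt)), ENNReal.mul_inv (Or.inl h2n0) (Or.inl h2nt),
      ENNReal.rpow_neg, ENNReal.rpow_neg]
  set μ : Measure (Rn n) := (volume B)⁻¹ • volume.restrict B with hμ
  set μ' : Measure (Rn n) := (volume B')⁻¹ • volume.restrict B' with hμ'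
  have i1 : IsProbabilityMeasure μ := ⟨by simp [hμ, ENNReal.inv_mul_cancel hv0 hvt]⟩
  have i2 : IsProbabilityMeasure μ' := ⟨by simp [hμ', ENNReal.inv_mul_cancel hv0' hvt']⟩
  have hac : μ ≪ volume :=
    Measure.smul_absolutelyContinuous.trans Measure.restrict_le_self.absolutelyContinuous
  have hac' : μ' ≪ volume :=
    Measure.smul_absolutelyContinuous.trans Measure.restrict_le_self.absolutelyContinuous
  have hint : Integrable u μ :=
    (hu.integrableOn_isCompact (isCompact_closedBall _ _)).smul_measure (by simp [hv0])
  have hint' : Integrable u μ' :=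
    (hu.integrableOn_isCompact (isCompact_closedBall _ _)).smul_measure (by simp [hv0'])
  have havg : (⨍ y in B, u y) = ∫ y, u y ∂μ := by
    rw [average, hμ]; simp
  have havg' : (⨍ y in B', u y) = ∫ y, u y ∂μ' := by
    rw [average, hμ']; simp
  have hdiff : (⨍ y in B, u y) - (⨍ y in B', u y) = ∫ z, (u z.1 - u z.2) ∂(μ.prod μ') := by
    rw [integral_sub (hint.comp_fst μ') (hint'.comp_snd μ), integral_fun_fst, integral_fun_snd,
      havg, havg']
    simp
  have hm : AEMeasurable (fun z : Rn n × Rn n => ‖u z.1 - u z.2‖ₑ) (μ.prod μ') :=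
    ((hu.aestronglyMeasurable.mono_ac hac).comp_fst.sub
      (hu.aestronglyMeasurable.mono_ac hac').comp_snd).aemeasurable.enorm
  have hprod : μ.prod μ' ≤ ((volume B)⁻¹ * (volume B')⁻¹) •
      (volume.restrict (B ×ˢ B') : Measure (Rn n × Rn n)) := by
    rw [hμ, hμ', Measure.prod_smul_left, Measure.prod_smul_right, smul_smul, Measure.prod_restrict,
      Measure.volume_eq_prod]
  have hker : ∫⁻ z in B ×ˢ B', ‖u z.1 - u z.2‖ₑ ^ q ≤
      (4 * S) ^ ((n : ℝ) + θ * q) * slobodeckij θ q u ^ q := by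
    rw [slobodeckij_rpow θ hq0, ← lintegral_const_mul' _ _
      (ENNReal.rpow_ne_top_of_nonneg (by positivity) (ENNReal.mul_ne_top (by simp) hSt))]
    refine le_trans ?_ (setLIntegral_le_lintegral (B ×ˢ B') _)
    refine setLIntegral_mono' (Metric.isClosed_closedBall.measurableSet.prod
      Metric.isClosed_closedBall.measurableSet) fun z hz => ?_
    refine enorm_sub_rpow_le_kernel hq0 (by positivity) u ?_
    have e4 : 4 * S = ENNReal.ofReal (4 * r) := by
      rw [ENNReal.ofReal_mul (by norm_num)]; simp [hS]
    rw [← ofReal_norm, e4]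
    refine ENNReal.ofReal_le_ofReal ?_
    rw [← dist_eq_norm]
    have h1 : dist z.1 x ≤ 2 * r := hz.1
    have h2 : dist z.2 x ≤ r := hz.2
    have h3 := dist_triangle_right z.1 z.2 x
    linarith
  have hfin : ‖(⨍ y in B, u y) - ⨍ y in B', u y‖ₑ ^ q ≤ (κ⁻¹ * κ⁻¹ *
      (2 ^ (-(n : ℝ)) * 4 ^ ((n : ℝ) + θ * q))) * S ^ (θ * q - n) * slobodeckij θ q u ^ q := by
    calc _ ≤ (∫⁻ z, ‖u z.1 - u z.2‖ₑ ∂(μ.prod μ')) ^ q := by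
          rw [hdiff]; gcongr; exact enorm_integral_le_lintegral_enorm _
      _ ≤ ∫⁻ z, ‖u z.1 - u z.2‖ₑ ^ q ∂(μ.prod μ') :=
          lintegral_rpow_le_of_isProbabilityMeasure hq hm
      _ ≤ ((volume B)⁻¹ * (volume B')⁻¹) * ∫⁻ z in B ×ˢ B', ‖u z.1 - u z.2‖ₑ ^ q := by
          refine (lintegral_mono' hprod le_rfl).trans_eq ?_
          rw [lintegral_smul_measure, smul_eq_mul]
      _ ≤ ((volume B)⁻¹ * (volume B')⁻¹) *
          ((4 * S) ^ ((n : ℝ) + θ * q) * slobodeckij θ q u ^ q) := by gcongr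
      _ = (κ⁻¹ * κ⁻¹ * (2 ^ (-(n : ℝ)) * 4 ^ ((n : ℝ) + θ * q))) *
          (S ^ (-(n : ℝ)) * S ^ (-(n : ℝ)) * S ^ ((n : ℝ) + θ * q)) * slobodeckij θ q u ^ q := by
          rw [hinv, hinv', ENNReal.mul_rpow_of_nonneg _ _ (by positivity)]; ring
      _ = _ := by
          rw [← ENNReal.rpow_add _ _ hS0 hSt, ← ENNReal.rpow_add _ _ hS0 hSt]
          ring_nf
  calc _ = (‖(⨍ y in B, u y) - ⨍ y in B', u y‖ₑ ^ q) ^ (1 / q) := by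
        rw [← ENNReal.rpow_mul, mul_one_div_cancel hq0.ne', ENNReal.rpow_one]
    _ ≤ _ := ENNReal.rpow_le_rpow hfin (by positivity)
    _ = _ := by
        rw [ENNReal.mul_rpow_of_nonneg _ _ (by positivity : 0 ≤ 1 / q),
          ENNReal.mul_rpow_of_nonneg _ (S ^ _) (by positivity : 0 ≤ 1 / q), ← ENNReal.rpow_mul S,
          ← ENNReal.rpow_mul (slobodeckij θ q u), mul_one_div_cancel hq0.ne', ENNReal.rpow_one]
        congr 3
        field_simp

/-- Morrey's embedding `W^{θ,q} ⊆ L^∞` for `θ > n / q`. -/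
theorem eLpNorm_top_le_slobodeckij {θ q : ℝ} (hθ : 0 ≤ θ) (hq : 1 ≤ q)
    (hlt : n / q < θ) : ∃ C : ℝ≥0∞, C ≠ ⊤ ∧ ∀ u : Rn n → ℝ,
      LocallyIntegrable u →
      eLpNorm u ⊤ volume ≤
        C * (eLpNorm u (ENNReal.ofReal q) volume + slobodeckij θ q u) := by
  have hq0 : 0 < q := by linarith
  set κ := volume (Metric.ball (0 : Rn n) 1) with hκ
  have hκ0 : κ ≠ 0 := (Metric.measure_ball_pos _ _ one_pos).ne'
  set D : ℝ≥0∞ := (κ⁻¹ * κ⁻¹ * (2 ^ (-(n : ℝ)) * 4 ^ ((n : ℝ) + θ * q))) ^ (1 / q) with hD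
  have hDt : D ≠ ⊤ := by
    refine ENNReal.rpow_ne_top_of_nonneg (by positivity) (ENNReal.mul_ne_top
      (ENNReal.mul_ne_top (by simpa) (by simpa)) (ENNReal.mul_ne_top (by simp) ?_))
    exact ENNReal.rpow_ne_top_of_nonneg (by positivity) (by simp)
  set ρ : ℝ := (1 / 2) ^ (θ - n / q) with hρ
  have hρ1 : ρ < 1 := Real.rpow_lt_one (by norm_num) (by norm_num) (by linarith)
  have hρ0 : 0 < ρ := by positivity
  set E : ℝ≥0∞ := κ⁻¹ ^ (1 / q) with hE
  have hEt : E ≠ ⊤ := ENNReal.rpow_ne_top_of_nonneg (by positivity) (by simpa)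
  set G : ℝ≥0∞ := D * ENNReal.ofReal (ρ / (1 - ρ)) with hG
  have hGt : G ≠ ⊤ := ENNReal.mul_ne_top hDt (by simp)
  refine ⟨1 + E + G, by simp [hEt, hGt], fun u hu => ?_⟩
  rcases eq_or_ne (slobodeckij θ q u) ⊤ with htop | htop
  · rw [htop]; simp
  set A : Rn n → ℕ → ℝ := fun x j => ⨍ y in Metric.closedBall x ((1 / 2) ^ j), u y with hA
  have hstep : ∀ x j, dist (A x j) (A x (j + 1)) ≤ (D * slobodeckij θ q u).toReal * ρ * ρ ^ j := by
    intro x j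
    have h := enorm_average_sub_average_le hθ hq hu x (r := (1 / 2) ^ (j + 1)) (by positivity)
    rw [show 2 * (1 / 2 : ℝ) ^ (j + 1) = (1 / 2) ^ j by rw [pow_succ]; ring] at h
    have e : ENNReal.ofReal ((1 / 2) ^ (j + 1)) ^ (θ - n / q) = ENNReal.ofReal (ρ * ρ ^ j) := by
      rw [ENNReal.ofReal_rpow_of_pos (by positivity), ← pow_succ', hρ, ← Real.rpow_natCast,
        ← Real.rpow_natCast, ← Real.rpow_mul (by norm_num), ← Real.rpow_mul (by norm_num),
        mul_comm]
    rw [e] at h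
    rw [dist_eq_norm, ← toReal_enorm, mul_assoc]
    have h' := ENNReal.toReal_mono (ENNReal.mul_ne_top (ENNReal.mul_ne_top hDt (by simp)) htop) h
    rw [ENNReal.toReal_mul, ENNReal.toReal_mul, ENNReal.toReal_ofReal (by positivity)] at h'
    rw [ENNReal.toReal_mul]
    calc _ ≤ _ := h'
      _ = _ := by ring
  have hlim := IsUnifLocDoublingMeasure.ae_tendsto_average (μ := (volume : Measure (Rn n))) hu 0
  rw [eLpNorm_exponent_top]
  refine eLpNormEssSup_le_of_ae_enorm_bound ?_
  filter_upwards [hlim] with x hx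
  have hx' : Tendsto (A x) atTop (nhds (u x)) := by
    refine hx (l := atTop) (fun _ => x) (fun j : ℕ => (1 / 2 : ℝ) ^ j) ?_ ?_
    · exact tendsto_pow_atTop_nhdsWithin_zero_of_lt_one (by norm_num) (by norm_num)
    · simp
  have hd := dist_le_of_le_geometric_of_tendsto₀ ρ _ hρ1 (hstep x) hx'
  have h0 : ‖A x 0‖ₑ ≤ E * eLpNorm u (ENNReal.ofReal q) volume := by
    have hv : volume (Metric.closedBall x 1) = κ := by
      rw [volume_closedBall_eq x one_pos.le]; simp [hκ]
    have hb : volume (Metric.closedBall x 1) ≠ ⊤ := measure_closedBall_lt_top.ne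
    have i1 : IsProbabilityMeasure (κ⁻¹ • volume.restrict (Metric.closedBall x 1)) := ⟨by
      simp [hv, ENNReal.inv_mul_cancel hκ0 (hv ▸ hb)]⟩
    have h1 : ‖A x 0‖ₑ ^ q ≤ κ⁻¹ * eLpNorm u (ENNReal.ofReal q) volume ^ q := by
      calc ‖A x 0‖ₑ ^ q ≤ (∫⁻ y, ‖u y‖ₑ ∂(κ⁻¹ • volume.restrict (Metric.closedBall x 1))) ^ q := by
            gcongr
            simp only [hA, pow_zero, average, Measure.restrict_apply_univ, hv]
            exact enorm_integral_le_lintegral_enorm _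
        _ ≤ ∫⁻ y, ‖u y‖ₑ ^ q ∂(κ⁻¹ • volume.restrict (Metric.closedBall x 1)) :=
            lintegral_rpow_le_of_isProbabilityMeasure hq
              (hu.aestronglyMeasurable.mono_ac (Measure.smul_absolutelyContinuous.trans
                Measure.restrict_le_self.absolutelyContinuous)).aemeasurable.enorm
        _ ≤ _ := by
            rw [lintegral_smul_measure, smul_eq_mul, eLpNorm_ofReal_rpow hq0]
            exact mul_le_mul' le_rfl (setLIntegral_le_lintegral _ _)
    calc ‖A x 0‖ₑ = (‖A x 0‖ₑ ^ q) ^ (1 / q) := by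
          rw [← ENNReal.rpow_mul, mul_one_div_cancel hq0.ne', ENNReal.rpow_one]
      _ ≤ _ := ENNReal.rpow_le_rpow h1 (by positivity)
      _ = _ := by
          rw [ENNReal.mul_rpow_of_nonneg _ _ (by positivity), ← ENNReal.rpow_mul,
            mul_one_div_cancel hq0.ne', ENNReal.rpow_one]
  have h1 : ‖u x - A x 0‖ₑ ≤ G * slobodeckij θ q u := by
    rw [← ofReal_norm, ← dist_eq_norm, dist_comm]
    refine (ENNReal.ofReal_le_ofReal hd).trans_eq ?_
    rw [mul_div_assoc, ENNReal.ofReal_mul ENNReal.toReal_nonneg,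
      ENNReal.ofReal_toReal (ENNReal.mul_ne_top hDt htop), hG]
    ring
  calc ‖u x‖ₑ = ‖A x 0 + (u x - A x 0)‖ₑ := by simp
    _ ≤ ‖A x 0‖ₑ + ‖u x - A x 0‖ₑ := enorm_add_le _ _
    _ ≤ E * eLpNorm u (ENNReal.ofReal q) volume + G * slobodeckij θ q u := add_le_add h0 h1
    _ ≤ (1 + E + G) * eLpNorm u (ENNReal.ofReal q) volume + (1 + E + G) * slobodeckij θ q u := by
        gcongr
        · exact le_add_self.trans le_self_add
        · exact le_add_self
    _ = _ := by ring

/-! ### Mollification and first-order weak derivatives -/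

/-- `g` is the weak derivative of `f` in the `i`-th coordinate direction. -/
def IsWeakPartial (i : Fin n) (f g : Rn n → ℝ) : Prop :=
  LocallyIntegrable f ∧ LocallyIntegrable g ∧
    ∀ φ : Rn n → ℝ, ContDiff ℝ ∞ φ → HasCompactSupport φ →
      ∫ x, partialD i φ x * f x = -∫ x, φ x * g x

/-- A smooth bump at the origin of `ℝⁿ`, supported in the ball of radius `1 / (j + 1)`. -/
def mollBump (n j : ℕ) : ContDiffBump (0 : Rn n) where
  rIn := 1 / (2 * (j + 1))
  rOut := 1 / (j + 1)
  rIn_pos := by positivity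
  rIn_lt_rOut := by
    apply one_div_lt_one_div_of_lt <;> nlinarith [(Nat.cast_nonneg j : (0 : ℝ) ≤ j)]

/-- The mollifying kernel, of integral one. -/
def mollKer (n j : ℕ) : Rn n → ℝ := (mollBump n j).normed volume

/-- The probability measure whose density is the mollifying kernel. -/
def mollMeasure (n j : ℕ) : Measure (Rn n) :=
  volume.withDensity fun y => ENNReal.ofReal (mollKer n j y)

/-- The mollification of `f` at scale `1 / (j + 1)`. -/
def moll (j : ℕ) (f : Rn n → ℝ) : Rn n → ℝ := fun x => ∫ t, mollKer n j (x - t) * f t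

theorem mollKer_contDiff (j : ℕ) : ContDiff ℝ ∞ (mollKer n j) :=
  (mollBump n j).contDiff_normed

theorem mollKer_hasCompactSupport (j : ℕ) : HasCompactSupport (mollKer n j) :=
  (mollBump n j).hasCompactSupport_normed

theorem mollKer_nonneg (j : ℕ) (x : Rn n) : 0 ≤ mollKer n j x :=
  (mollBump n j).nonneg_normed x

instance mollMeasure_isProbabilityMeasure (j : ℕ) : IsProbabilityMeasure (mollMeasure n j) := ⟨by
  rw [mollMeasure, withDensity_apply _ MeasurableSet.univ, Measure.restrict_univ]
  simp only [mollKer]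
  rw [← ofReal_integral_eq_lintegral_ofReal (mollBump n j).integrable_normed
      (Eventually.of_forall (mollKer_nonneg j)), (mollBump n j).integral_normed,
    ENNReal.ofReal_one]⟩

theorem mollMeasure_absolutelyContinuous (j : ℕ) : mollMeasure n j ≪ volume :=
  withDensity_absolutelyContinuous _ _

theorem moll_eq_convolution_left (j : ℕ) (f : Rn n → ℝ) :
    moll j f = convolution (mollKer n j) f (ContinuousLinearMap.lsmul ℝ ℝ) volume := by
  funext x
  rw [convolution_eq_swap]
  rfl

theorem moll_eq_convolution_right (j : ℕ) (f : Rn n → ℝ) :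
    moll j f = convolution f (mollKer n j) (ContinuousLinearMap.lsmul ℝ ℝ).flip volume := rfl

theorem moll_contDiff (j : ℕ) {f : Rn n → ℝ} (hf : LocallyIntegrable f) :
    ContDiff ℝ ∞ (moll j f) := by
  rw [moll_eq_convolution_left]
  exact (mollKer_hasCompactSupport j).contDiff_convolution_left _ (mollKer_contDiff j) hf

theorem moll_ae_tendsto {f : Rn n → ℝ} (hf : LocallyIntegrable f) :
    ∀ᵐ x, Tendsto (fun j => moll j f x) atTop (nhds (f x)) := by
  have h := ContDiffBump.ae_convolution_tendsto_right_of_locallyIntegrable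
    (φ := fun j => mollBump n j) (l := atTop) (K := 2) tendsto_one_div_add_atTop_nhds_zero_nat
    (Eventually.of_forall fun j => by
      simp only [mollBump]
      apply le_of_eq
      field_simp) hf
  filter_upwards [h] with x hx
  simpa only [moll_eq_convolution_left, mollKer] using hx

theorem enorm_moll_le (j : ℕ) {f : Rn n → ℝ} (hf : AEStronglyMeasurable f) (x : Rn n) :
    ‖moll j f x‖ₑ ≤ ∫⁻ y, ‖f (x - y)‖ₑ ∂mollMeasure n j := by
  have hm : AEMeasurable (fun y => ‖f (x - y)‖ₑ) volume :=
    (hf.comp_quasiMeasurePreserving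
      (quasiMeasurePreserving_sub_left_of_right_invariant volume x)).aemeasurable.enorm
  rw [mollMeasure, lintegral_withDensity_eq_lintegral_mul₀
    ((mollKer_contDiff j).continuous.measurable.ennreal_ofReal.aemeasurable) hm,
    moll_eq_convolution_left, convolution_def]
  refine (enorm_integral_le_lintegral_enorm _).trans (lintegral_mono fun y => ?_)
  simp only [ContinuousLinearMap.lsmul_apply, smul_eq_mul, enorm_mul, Pi.mul_apply]
  rw [Real.enorm_eq_ofReal (mollKer_nonneg j y)]

/-- Mollification does not increase the `L^q` norm. -/
theorem eLpNorm_moll_le (j : ℕ) {q : ℝ≥0∞} (hq : 1 ≤ q) {f : Rn n → ℝ}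
    (hf : AEStronglyMeasurable f) : eLpNorm (moll j f) q volume ≤ eLpNorm f q volume := by
  rcases eq_or_ne q ⊤ with rfl | hqt
  · simp only [eLpNorm_exponent_top]
    refine eLpNormEssSup_le_of_ae_enorm_bound (Eventually.of_forall fun x => ?_)
    refine (enorm_moll_le j hf x).trans ?_
    have h : ∀ᵐ y ∂mollMeasure n j, ‖f (x - y)‖ₑ ≤ eLpNormEssSup f volume :=
      (mollMeasure_absolutelyContinuous j).ae_le
        ((quasiMeasurePreserving_sub_left_of_right_invariant volume x).ae
          (enorm_ae_le_eLpNormEssSup f volume))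
    exact (lintegral_mono_ae h).trans (by simp)
  obtain ⟨r, hr, rfl⟩ : ∃ r : ℝ, 1 ≤ r ∧ q = ENNReal.ofReal r :=
    ⟨q.toReal, by simpa using ENNReal.toReal_mono hqt hq, (ENNReal.ofReal_toReal hqt).symm⟩
  have hr0 : 0 < r := by linarith
  have hm : AEStronglyMeasurable (fun z : Rn n × Rn n => f (z.1 - z.2))
      (volume.prod (mollMeasure n j)) :=
    hf.comp_quasiMeasurePreserving (quasiMeasurePreserving_sub_of_right_invariant _ _)
  have hmx : ∀ x, AEMeasurable (fun y => ‖f (x - y)‖ₑ) (mollMeasure n j) := fun x =>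
    ((hf.comp_quasiMeasurePreserving (quasiMeasurePreserving_sub_left_of_right_invariant volume
      x)).mono_ac (mollMeasure_absolutelyContinuous j)).aemeasurable.enorm
  rw [eLpNorm_ofReal_eq hr0, eLpNorm_ofReal_eq hr0]
  refine ENNReal.rpow_le_rpow ?_ (by positivity)
  calc ∫⁻ x, ‖moll j f x‖ₑ ^ r ≤ ∫⁻ x, ∫⁻ y, ‖f (x - y)‖ₑ ^ r ∂mollMeasure n j := by
        refine lintegral_mono fun x => ?_
        refine (ENNReal.rpow_le_rpow (enorm_moll_le j hf x) hr0.le).trans ?_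
        exact lintegral_rpow_le_of_isProbabilityMeasure hr (hmx x)
    _ = ∫⁻ y, ∫⁻ x, ‖f (x - y)‖ₑ ^ r ∂volume ∂mollMeasure n j :=
        lintegral_lintegral_swap (hm.aemeasurable.enorm.pow_const r)
    _ = ∫⁻ _, ∫⁻ x, ‖f x‖ₑ ^ r ∂volume ∂mollMeasure n j := by
        congr 1; funext y
        exact lintegral_sub_right_eq_self (fun x => ‖f x‖ₑ ^ r) y
    _ = _ := by simp

theorem partialD_comp_sub (i : Fin n) {φ : Rn n → ℝ} (hφ : Differentiable ℝ φ) (x t : Rn n) :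
    partialD i (fun t => φ (x - t)) t = -partialD i φ (x - t) := by
  have h : HasFDerivAt (fun t => φ (x - t)) ((fderiv ℝ φ (x - t)).comp
      (-ContinuousLinearMap.id ℝ (Rn n))) t :=
    (hφ (x - t)).hasFDerivAt.comp t ((hasFDerivAt_id t).const_sub x)
  simp [partialD, h.fderiv]

/-- Mollification commutes with weak derivatives. -/
theorem partialD_moll (j : ℕ) {i : Fin n} {f g : Rn n → ℝ} (h : IsWeakPartial i f g) :
    partialD i (moll j f) = moll j g := by
  funext x
  have hc := mollKer_hasCompactSupport (n := n) j
  have hs := mollKer_contDiff (n := n) j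
  have h1 := hc.hasFDerivAt_convolution_right (ContinuousLinearMap.lsmul ℝ ℝ).flip h.1
    (hs.of_le (by simp)) x
  rw [← moll_eq_convolution_right] at h1
  rw [partialD, h1.fderiv, convolution_precompR_apply _ h.1 (hc.fderiv ℝ)
    (hs.continuous_fderiv (by simp)), convolution_def]
  have h2 := h.2.2 (fun t => mollKer n j (x - t)) (hs.comp (contDiff_const.sub contDiff_id))
    (hc.comp_homeomorph (Homeomorph.subLeft x))
  simp only [partialD_comp_sub i (hs.differentiable (by simp)), neg_mul, integral_neg,
    neg_inj] at h2
  exact h2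

theorem tendsto_integral_moll_mul_of_bounded {f H : Rn n → ℝ} (hf : LocallyIntegrable f)
    (hft : eLpNorm f ⊤ volume ≠ ⊤) (hH : Integrable H) :
    Tendsto (fun j => ∫ x, moll j f x * H x) atTop (nhds (∫ x, f x * H x)) := by
  refine tendsto_integral_of_dominated_convergence
    (fun x => (eLpNorm f ⊤ volume).toReal * ‖H x‖) (fun j => ?_) (hH.norm.const_mul _)
    (fun j => ?_) ?_
  · exact (moll_contDiff j hf).continuous.aestronglyMeasurable.mul hH.1
  · have h1 : ∀ᵐ x, ‖moll j f x‖ₑ ≤ eLpNorm f ⊤ volume := by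
      filter_upwards [enorm_ae_le_eLpNormEssSup (moll j f) volume] with x hx
      refine hx.trans ?_
      rw [← eLpNorm_exponent_top]
      exact eLpNorm_moll_le j le_top hf.aestronglyMeasurable
    filter_upwards [h1] with x hx
    rw [norm_mul]
    gcongr
    rw [← toReal_enorm]
    exact ENNReal.toReal_mono hft hx
  · filter_upwards [moll_ae_tendsto hf] with x hx
    exact hx.mul_const _

theorem enorm_integral_mul_mul_le {a b p c : ℝ≥0∞} [ENNReal.HolderTriple a b p]
    [ENNReal.HolderTriple c p 1] {φ f g : Rn n → ℝ} (hφ : AEStronglyMeasurable φ)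
    (hf : AEStronglyMeasurable f) (hg : AEStronglyMeasurable g) :
    ‖∫ x, φ x * (f x * g x)‖ₑ ≤
      eLpNorm φ c volume * (eLpNorm f a volume * eLpNorm g b volume) := by
  have h1 : eLpNorm (φ • (f • g)) 1 volume ≤ eLpNorm φ c volume * eLpNorm (f • g) p volume :=
    eLpNorm_smul_le_mul_eLpNorm (hf.smul hg) hφ
  have h2 : eLpNorm (f • g) p volume ≤ eLpNorm f a volume * eLpNorm g b volume :=
    eLpNorm_smul_le_mul_eLpNorm hg hf
  refine (enorm_integral_le_lintegral_enorm _).trans ?_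
  rw [eLpNorm_one_eq_lintegral_enorm] at h1
  exact h1.trans (mul_le_mul' le_rfl h2)

theorem one_le_of_holderTriple {a b p : ℝ≥0∞} (hp : 1 ≤ p) [h : ENNReal.HolderTriple a b p] :
    1 ≤ a := by
  have h1 := h.inv_add_inv_eq_inv
  rw [← ENNReal.inv_le_inv, inv_one]
  exact (le_self_add.trans h1.le).trans (by simpa using hp)

/-- Products of mollifications converge weakly, at all Hölder exponents: for a finite exponent of
the mollified factor by density of the test functions, for the exponent `∞` by dominated
convergence. -/
theorem tendsto_integral_moll_mul {a b p : ℝ≥0∞} (hp : 1 ≤ p) [h : ENNReal.HolderTriple a b p]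
    {φ f g : Rn n → ℝ} (hφ : Continuous φ) (hφc : HasCompactSupport φ) (hf : MemLp f a volume)
    (hg : MemLp g b volume) :
    Tendsto (fun j => ∫ x, φ x * (moll j f x * g x)) atTop (nhds (∫ x, φ x * (f x * g x))) := by
  have ha : 1 ≤ a := one_le_of_holderTriple (h := h) hp
  have hb : 1 ≤ b := one_le_of_holderTriple (h := h.symm) hp
  have hgl : LocallyIntegrable g := hg.locallyIntegrable hb
  have hfl : LocallyIntegrable f := hf.locallyIntegrable ha
  have hH : Integrable (fun x => φ x * g x) := by
    simpa using hgl.integrable_smul_left_of_hasCompactSupport hφ hφc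
  have comm : ∀ w : Rn n → ℝ, ∫ x, φ x * (w x * g x) = ∫ x, w x * (φ x * g x) := fun w => by
    congr 1; funext x; ring
  rcases eq_or_ne a ⊤ with rfl | hat
  · simp only [comm]
    exact tendsto_integral_moll_mul_of_bounded hfl hf.2.ne hH
  set c := ENNReal.conjExponent p with hc
  have hpc : ENNReal.HolderConjugate p c := ENNReal.HolderConjugate.conjExponent hp
  have hcp : ENNReal.HolderTriple c p 1 := hpc.symm
  have hφL : MemLp φ c volume := hφ.memLp_of_hasCompactSupport hφc
  set M : ℝ≥0∞ := eLpNorm φ c volume * eLpNorm g b volume with hM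
  have hMt : M ≠ ⊤ := ENNReal.mul_ne_top hφL.2.ne hg.2.ne
  have hint : ∀ w : Rn n → ℝ, MemLp w a volume → Integrable (fun x => φ x * (w x * g x)) := by
    intro w hw
    have h1 : MemLp (w * g) p volume := hg.mul hw
    rw [← memLp_one_iff_integrable]
    exact h1.mul hφL
  have hbound : ∀ w : Rn n → ℝ, AEStronglyMeasurable w →
      ‖∫ x, φ x * (w x * g x)‖ₑ ≤ M * eLpNorm w a volume := by
    intro w hw
    refine (enorm_integral_mul_mul_le (a := a) (b := b) (p := p) (c := c) hφL.1 hw hg.1).trans_eq ?_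
    rw [hM]; ring
  rw [tendsto_iff_edist_tendsto_0, ENNReal.tendsto_atTop_zero]
  intro ε hε
  -- the approximation of `f` is chosen to within `δ`
  obtain ⟨δ, hδ0, hδ⟩ : ∃ δ : ℝ, 0 < δ ∧ M * ENNReal.ofReal δ ≤ ε / 3 := by
    have hε3 : ε / 3 ≠ 0 := (ENNReal.div_pos hε.ne' (by simp)).ne'
    obtain ⟨δ, hδ0, hδ⟩ := ENNReal.exists_nnreal_pos_mul_lt hMt hε3
    exact ⟨δ, hδ0, by rw [mul_comm]; simpa using hδ.le⟩
  obtain ⟨w, hwc, hws, hwf⟩ := MeasureTheory.MemLp.exist_eLpNorm_sub_le hat ha hf hδ0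
  have hwL : MemLp w a volume := hws.continuous.memLp_of_hasCompactSupport hwc
  have hwl : LocallyIntegrable w := hwL.locallyIntegrable ha
  have hlim : Tendsto (fun j => ∫ x, φ x * (moll j w x * g x)) atTop
      (nhds (∫ x, φ x * (w x * g x))) := by
    simp only [comm]
    exact tendsto_integral_moll_mul_of_bounded hwl
      (hws.continuous.memLp_of_hasCompactSupport hwc).2.ne hH
  rw [tendsto_iff_edist_tendsto_0, ENNReal.tendsto_atTop_zero] at hlim
  obtain ⟨N, hN⟩ := hlim (ε / 3) (ENNReal.div_pos hε.ne' (by simp))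
  refine ⟨N, fun j hj => ?_⟩
  have hmL : ∀ v : Rn n → ℝ, MemLp v a volume → MemLp (moll j v) a volume := fun v hv =>
    ⟨(moll_contDiff j (hv.locallyIntegrable ha)).continuous.aestronglyMeasurable,
      (eLpNorm_moll_le j ha hv.1).trans_lt hv.2⟩
  have hmsub : moll j f - moll j w = moll j (f - w) := by
    funext x
    have hi : ∀ v : Rn n → ℝ, LocallyIntegrable v →
        Integrable (fun t => mollKer n j (x - t) * v t) := fun v hv => by
      simpa using hv.integrable_smul_left_of_hasCompactSupport
        ((mollKer_contDiff j).continuous.comp (continuous_const.sub continuous_id))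
        ((mollKer_hasCompactSupport j).comp_homeomorph (Homeomorph.subLeft x))
    simp only [moll, Pi.sub_apply, mul_sub]
    rw [integral_sub (hi f hfl) (hi w hwl)]
  have e1 : edist (∫ x, φ x * (moll j f x * g x)) (∫ x, φ x * (moll j w x * g x)) ≤ ε / 3 := by
    rw [edist_eq_enorm_sub, ← integral_sub (hint _ (hmL f hf)) (hint _ (hmL w hwL))]
    have : (fun x => φ x * (moll j f x * g x) - φ x * (moll j w x * g x)) =
        fun x => φ x * ((moll j f - moll j w) x * g x) := by
      funext x; simp only [Pi.sub_apply]; ring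
    rw [this, hmsub]
    refine (hbound _ (moll_contDiff j (hfl.sub hwl)).continuous.aestronglyMeasurable).trans ?_
    refine le_trans ?_ hδ
    gcongr
    exact (eLpNorm_moll_le j ha (hf.1.sub hwL.1)).trans hwf
  have e2 : edist (∫ x, φ x * (w x * g x)) (∫ x, φ x * (f x * g x)) ≤ ε / 3 := by
    rw [edist_comm, edist_eq_enorm_sub, ← integral_sub (hint _ hf) (hint _ hwL)]
    have : (fun x => φ x * (f x * g x) - φ x * (w x * g x)) =
        fun x => φ x * ((f - w) x * g x) := by
      funext x; simp only [Pi.sub_apply]; ring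
    rw [this]
    refine (hbound _ (hf.1.sub hwL.1)).trans (le_trans ?_ hδ)
    gcongr
  calc _ ≤ edist (∫ x, φ x * (moll j f x * g x)) (∫ x, φ x * (moll j w x * g x)) +
        edist (∫ x, φ x * (moll j w x * g x)) (∫ x, φ x * (w x * g x)) +
        edist (∫ x, φ x * (w x * g x)) (∫ x, φ x * (f x * g x)) := edist_triangle4 _ _ _ _
    _ ≤ ε / 3 + ε / 3 + ε / 3 := add_le_add (add_le_add e1 (hN j hj)) e2
    _ = ε := ENNReal.add_thirds ε

/-- The product rule for weak derivatives, when the three products involved satisfy Hölder's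
inequality with values in one and the same `L^p`. -/
theorem IsWeakPartial.mul {i : Fin n} {f f' g g' : Rn n → ℝ} (hf : IsWeakPartial i f f')
    (hg : IsWeakPartial i g g') {p a₀ b₀ a₁ b₁ a₂ b₂ : ℝ≥0∞} (hp : 1 ≤ p)
    [t₀ : ENNReal.HolderTriple a₀ b₀ p] [t₁ : ENNReal.HolderTriple a₁ b₁ p]
    [t₂ : ENNReal.HolderTriple a₂ b₂ p] (hf₀ : MemLp f a₀ volume) (hg₀ : MemLp g b₀ volume)
    (hf₁ : MemLp f' a₁ volume) (hg₁ : MemLp g b₁ volume) (hf₂ : MemLp f a₂ volume)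
    (hg₂ : MemLp g' b₂ volume) : IsWeakPartial i (f * g) (f' * g + f * g') := by
  have l₀ : LocallyIntegrable (f * g) := (hg₀.mul (r := p) hf₀).locallyIntegrable hp
  have l₁ : LocallyIntegrable (f' * g) := (hg₁.mul (r := p) hf₁).locallyIntegrable hp
  have l₂ : LocallyIntegrable (f * g') := (hg₂.mul (r := p) hf₂).locallyIntegrable hp
  refine ⟨l₀, l₁.add l₂, fun φ hφ hφc => ?_⟩
  have hdφ := partialD_smooth i hφ
  have hdφc := partialD_compact i hφc
  have T₀ := tendsto_integral_moll_mul hp hdφ.continuous hdφc hf₀ hg₀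
  have T₁ := tendsto_integral_moll_mul hp hφ.continuous hφc hf₁ hg₁
  have T₂ := tendsto_integral_moll_mul hp hφ.continuous hφc hf₂ hg₂
  have hid : ∀ j, ∫ x, partialD i φ x * (moll j f x * g x) =
      -((∫ x, φ x * (moll j f' x * g x)) + ∫ x, φ x * (moll j f x * g' x)) := by
    intro j
    have hm : ContDiff ℝ ∞ (moll j f) := moll_contDiff j hf.1
    have hm' : ContDiff ℝ ∞ (moll j f') := moll_contDiff j hf.2.1
    have hprod : ∀ x, partialD i (fun x => φ x * moll j f x) x =
        partialD i φ x * moll j f x + φ x * moll j f' x := by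
      intro x
      rw [← partialD_moll j hf]
      have := ((hφ.differentiable (by simp) x).hasFDerivAt.mul
        (hm.differentiable (by simp) x).hasFDerivAt).fderiv
      simp only [partialD]
      rw [show (fun x => φ x * moll j f x) = φ * moll j f from rfl, this]
      simp
      ring
    have hw := hg.2.2 (fun x => φ x * moll j f x) (hφ.mul hm) hφc.mul_right
    simp only [hprod, add_mul] at hw
    have i₁ : Integrable (fun x => partialD i φ x * moll j f x * g x) :=
      test_integrable (hdφ.mul hm) hdφc.mul_right hg.1
    have i₂ : Integrable (fun x => φ x * moll j f' x * g x) :=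
      test_integrable (hφ.mul hm') hφc.mul_right hg.1
    rw [integral_add i₁ i₂] at hw
    simp only [← mul_assoc]
    linarith
  simp only [hid] at T₀
  have := tendsto_nhds_unique T₀ (T₁.add T₂).neg
  simp only [Pi.add_apply, Pi.mul_apply, mul_add]
  have hadd := integral_add (test_integrable hφ hφc l₁) (test_integrable hφ hφc l₂)
  simp only [Pi.mul_apply] at hadd
  rw [hadd]
  exact this

/-! ### First-order Sobolev embeddings -/

/-- The modulus of continuity in `L^q` of a smooth function. -/
theorem eLpNorm_translate_sub_le_fderiv {q : ℝ} (hq : 1 ≤ q) {w : Rn n → ℝ}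
    (hw : ContDiff ℝ ∞ w) (h : Rn n) :
    eLpNorm (fun x => w (x + h) - w x) (ENNReal.ofReal q) volume ≤
      ‖h‖ₑ * eLpNorm (fderiv ℝ w) (ENNReal.ofReal q) volume := by
  have hq0 : 0 < q := by linarith
  have hcont : Continuous (fderiv ℝ w) := hw.continuous_fderiv (by simp)
  set ν : Measure ℝ := volume.restrict (Ioc 0 1) with hν
  have : IsProbabilityMeasure ν := ⟨by simp [hν]⟩
  have hpt : ∀ x, ‖w (x + h) - w x‖ₑ ≤ ‖h‖ₑ * ∫⁻ t, ‖fderiv ℝ w (x + t • h)‖ₑ ∂ν := by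
    intro x
    have hd : ∀ t : ℝ, HasDerivAt (fun t : ℝ => w (x + t • h)) (fderiv ℝ w (x + t • h) h) t := by
      intro t
      have h1 : HasDerivAt (fun t : ℝ => x + t • h) h t := by
        simpa using ((hasDerivAt_id t).smul_const h).const_add x
      exact ((hw.differentiable (by simp) _).hasFDerivAt).comp_hasDerivAt t h1
    have hc : Continuous (fun t : ℝ => fderiv ℝ w (x + t • h) h) := by fun_prop
    have hI := intervalIntegral.integral_eq_sub_of_hasDerivAt (a := 0) (b := 1)
      (fun t _ => hd t) (hc.intervalIntegrable _ _)
    simp only [one_smul, zero_smul, add_zero] at hI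
    rw [← hI, intervalIntegral.integral_of_le zero_le_one]
    refine (enorm_integral_le_lintegral_enorm _).trans ?_
    rw [← lintegral_const_mul' _ _ enorm_ne_top]
    refine lintegral_mono fun t => ?_
    rw [mul_comm]
    exact ContinuousLinearMap.le_opENorm _ _
  have hc2 : Continuous (fun z : Rn n × ℝ => ‖fderiv ℝ w (z.1 + z.2 • h)‖ₑ ^ q) := by
    have : Continuous (fun z : Rn n × ℝ => fderiv ℝ w (z.1 + z.2 • h)) := by fun_prop
    exact ENNReal.continuous_rpow_const.comp this.enorm
  have hF : eLpNorm (fderiv ℝ w) (ENNReal.ofReal q) volume =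
      (∫⁻ x, ‖fderiv ℝ w x‖ₑ ^ q) ^ (1 / q) := by
    rw [eLpNorm_eq_lintegral_rpow_enorm_toReal (by simpa using hq0) (by simp),
      ENNReal.toReal_ofReal hq0.le]
  rw [eLpNorm_ofReal_eq hq0, hF]
  calc (∫⁻ x, ‖w (x + h) - w x‖ₑ ^ q) ^ (1 / q)
      ≤ (‖h‖ₑ ^ q * ∫⁻ x, ∫⁻ t, ‖fderiv ℝ w (x + t • h)‖ₑ ^ q ∂ν) ^ (1 / q) := by
        gcongr
        rw [← lintegral_const_mul' _ _ (ENNReal.rpow_ne_top_of_nonneg hq0.le enorm_ne_top)]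
        refine lintegral_mono fun x => ?_
        refine (ENNReal.rpow_le_rpow (hpt x) hq0.le).trans ?_
        rw [ENNReal.mul_rpow_of_nonneg _ _ hq0.le]
        gcongr
        refine lintegral_rpow_le_of_isProbabilityMeasure hq ?_
        have : Continuous (fun t : ℝ => fderiv ℝ w (x + t • h)) := by fun_prop
        exact this.enorm.measurable.aemeasurable
    _ = (‖h‖ₑ ^ q * ∫⁻ x, ‖fderiv ℝ w x‖ₑ ^ q) ^ (1 / q) := by
        rw [lintegral_lintegral_swap hc2.measurable.aemeasurable]
        congr 2
        have : ∀ t : ℝ, ∫⁻ x, ‖fderiv ℝ w (x + t • h)‖ₑ ^ q = ∫⁻ x, ‖fderiv ℝ w x‖ₑ ^ q :=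
          fun t => lintegral_add_right_eq_self (fun x => ‖fderiv ℝ w x‖ₑ ^ q) (t • h)
        simp [this]
    _ = _ := by
        rw [ENNReal.mul_rpow_of_nonneg _ _ (by positivity), ← ENNReal.rpow_mul,
          mul_one_div_cancel hq0.ne', ENNReal.rpow_one]

theorem norm_fderiv_le_sum_partialD (w : Rn n → ℝ) (x : Rn n) :
    ‖fderiv ℝ w x‖ ≤ ∑ i, |partialD i w x| := by
  refine ContinuousLinearMap.opNorm_le_bound _ (by positivity) fun h => ?_
  have hsum : h = ∑ i, h i • EuclideanSpace.single i (1 : ℝ) := by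
    ext j
    simp [Finset.sum_apply, Pi.single_apply]
  conv_lhs => rw [hsum, map_sum]
  rw [Finset.sum_mul]
  refine (norm_sum_le _ _).trans (Finset.sum_le_sum fun i _ => ?_)
  rw [map_smul, norm_smul, mul_comm]
  exact mul_le_mul_of_nonneg_left (PiLp.norm_apply_le h i) (norm_nonneg _)

theorem eLpNorm_fderiv_moll_le (j : ℕ) {q : ℝ} (hq : 1 ≤ q) {f : Rn n → ℝ} {g : Fin n → Rn n → ℝ}
    (hg : ∀ i, IsWeakPartial i f (g i)) :
    eLpNorm (fderiv ℝ (moll j f)) (ENNReal.ofReal q) volume ≤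
      ∑ i, eLpNorm (g i) (ENNReal.ofReal q) volume := by
  have hq' : 1 ≤ ENNReal.ofReal q := by simpa using hq
  have hm : ∀ i, AEStronglyMeasurable (moll j (g i)) volume := fun i =>
    (moll_contDiff j (hg i).2.1).continuous.aestronglyMeasurable
  calc _ ≤ eLpNorm (∑ i, fun x => |moll j (g i) x|) (ENNReal.ofReal q) volume := by
        refine eLpNorm_mono_real fun x => ?_
        refine (norm_fderiv_le_sum_partialD _ x).trans_eq ?_
        simp only [Finset.sum_apply]
        exact Finset.sum_congr rfl fun i _ => by rw [partialD_moll j (hg i)]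
    _ ≤ ∑ i, eLpNorm (fun x => |moll j (g i) x|) (ENNReal.ofReal q) volume :=
        eLpNorm_sum_le (fun i _ => (hm i).norm) hq'
    _ ≤ _ := by
        refine Finset.sum_le_sum fun i _ => ?_
        refine (eLpNorm_norm (moll j (g i))).trans_le ?_
        exact eLpNorm_moll_le j hq' (hg i).2.1.aestronglyMeasurable

theorem eLpNorm_translate_sub_le {q : ℝ} (hq : 1 ≤ q) (hn : 0 < n) {f : Rn n → ℝ}
    {g : Fin n → Rn n → ℝ} (hg : ∀ i, IsWeakPartial i f (g i)) (h : Rn n) :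
    eLpNorm (fun x => f (x + h) - f x) (ENNReal.ofReal q) volume ≤
      ‖h‖ₑ * ∑ i, eLpNorm (g i) (ENNReal.ofReal q) volume := by
  have hf : LocallyIntegrable f := (hg ⟨0, hn⟩).1
  have hlim := moll_ae_tendsto hf
  have hlim' : ∀ᵐ x, Tendsto (fun j => moll j f (x + h)) atTop (nhds (f (x + h))) :=
    (measurePreserving_add_right volume h).quasiMeasurePreserving.ae hlim
  refine Lp.eLpNorm_le_of_ae_tendsto (u := atTop)
    (f := fun j x => moll j f (x + h) - moll j f x)
    (Eventually.of_forall fun j => ?_) (fun j => ?_) ?_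
  · refine (eLpNorm_translate_sub_le_fderiv hq (moll_contDiff j hf) h).trans ?_
    gcongr
    exact eLpNorm_fderiv_moll_le j hq hg
  · have := (moll_contDiff j hf).continuous
    exact (by fun_prop : Continuous fun x => moll j f (x + h) - moll j f x).aestronglyMeasurable
  · filter_upwards [hlim, hlim'] with x h1 h2
    exact h2.sub h1

/-- The radial integral that compares first-order differences with the Slobodeckij seminorm. -/
theorem lintegral_min_div_rpow_lt_top (hn : 0 < n) {θ q : ℝ} (hθ0 : 0 < θ) (hθ1 : θ < 1)
    (hq : 0 < q) : ∫⁻ h : Rn n, min (‖h‖ₑ ^ q) 1 / ‖h‖ₑ ^ ((n : ℝ) + θ * q) < ⊤ := by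
  have : Nonempty (Fin n) := ⟨⟨0, hn⟩⟩
  set F : ℝ → ℝ := fun ρ => if ρ < 1 then ρ ^ (q - (n + θ * q)) else ρ ^ (-((n : ℝ) + θ * q))
    with hF
  have hn1 : ((n - 1 : ℕ) : ℝ) = n - 1 := by rw [Nat.cast_sub hn]; simp
  have hint : Integrable (fun h : Rn n => F ‖h‖) volume := by
    rw [integrable_fun_norm_addHaar, ← Ioo_union_Ici_eq_Ioi one_pos, integrableOn_union]
    constructor
    · have h1 : IntegrableOn (fun ρ : ℝ => ρ ^ ((1 - θ) * q - 1)) (Ioo 0 1) :=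
        (intervalIntegral.integrableOn_Ioo_rpow_iff one_pos).2 (by nlinarith)
      refine h1.congr_fun (fun ρ hρ => ?_) measurableSet_Ioo
      simp only [hF, if_pos hρ.2, finrank_euclideanSpace_fin, smul_eq_mul]
      rw [← Real.rpow_natCast, ← Real.rpow_add hρ.1, hn1]
      ring_nf
    · rw [integrableOn_Ici_iff_integrableOn_Ioi]
      have h1 : IntegrableOn (fun ρ : ℝ => ρ ^ (-(θ * q) - 1)) (Ioi 1) :=
        integrableOn_Ioi_rpow_of_lt (by nlinarith) one_pos
      refine h1.congr_fun (fun ρ hρ => ?_) measurableSet_Ioi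
      have hρ' : (1 : ℝ) < ρ := hρ
      simp only [hF, if_neg hρ'.not_gt, finrank_euclideanSpace_fin, smul_eq_mul]
      rw [← Real.rpow_natCast, ← Real.rpow_add (by linarith), hn1]
      ring_nf
  refine lt_of_le_of_lt ?_ hint.2
  refine lintegral_mono_ae ?_
  filter_upwards [compl_mem_ae_iff.2 (measure_singleton (0 : Rn n))] with h hh
  have hpos : 0 < ‖h‖ := norm_pos_iff.2 hh
  have e : ∀ s : ℝ, ‖h‖ₑ ^ s = ENNReal.ofReal (‖h‖ ^ s) := fun s => by
    rw [← ofReal_norm, ENNReal.ofReal_rpow_of_pos hpos]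
  rw [Real.enorm_eq_ofReal (by simp only [hF]; split_ifs <;> positivity), div_eq_mul_inv,
    ← ENNReal.rpow_neg]
  by_cases h1 : ‖h‖ < 1
  · calc _ ≤ ‖h‖ₑ ^ q * ‖h‖ₑ ^ (-((n : ℝ) + θ * q)) := by gcongr; exact min_le_left _ _
      _ = _ := by
        rw [e, e, ← ENNReal.ofReal_mul (by positivity), ← Real.rpow_add hpos]
        simp only [hF, if_pos h1]
        ring_nf
  · calc _ ≤ 1 * ‖h‖ₑ ^ (-((n : ℝ) + θ * q)) := by gcongr; exact min_le_right _ _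
      _ = _ := by
        rw [e, one_mul]
        simp only [hF, if_neg h1]

/-- `W^{1,q}` is contained in `W^{θ,q}` for `0 < θ < 1`. -/
theorem slobodeckij_le_of_isWeakPartial (hn : 0 < n) {θ q : ℝ} (hθ0 : 0 < θ) (hθ1 : θ < 1)
    (hq : 1 ≤ q) : ∃ C : ℝ≥0∞, C ≠ ⊤ ∧ ∀ (f : Rn n → ℝ) (g : Fin n → Rn n → ℝ),
      (∀ i, IsWeakPartial i f (g i)) → slobodeckij θ q f ≤
        C * (eLpNorm f (ENNReal.ofReal q) volume +
          ∑ i, eLpNorm (g i) (ENNReal.ofReal q) volume) := by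
  have hq0 : 0 < q := by linarith
  set I : ℝ≥0∞ := ∫⁻ h : Rn n, min (‖h‖ₑ ^ q) 1 / ‖h‖ₑ ^ ((n : ℝ) + θ * q) with hI
  have hIt : I ≠ ⊤ := (lintegral_min_div_rpow_lt_top hn hθ0 hθ1 hq0).ne
  refine ⟨2 * I ^ (1 / q), ENNReal.mul_ne_top (by simp)
    (ENNReal.rpow_ne_top_of_nonneg (by positivity) hIt), fun f g hg => ?_⟩
  have hf : LocallyIntegrable f := (hg ⟨0, hn⟩).1
  set A : ℝ≥0∞ := 2 * (eLpNorm f (ENNReal.ofReal q) volume +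
    ∑ i, eLpNorm (g i) (ENNReal.ofReal q) volume) with hA
  have hdiff : ∀ h : Rn n, ∫⁻ x, ‖f x - f (x + h)‖ₑ ^ q ≤ min (‖h‖ₑ ^ q) 1 * A ^ q := by
    intro h
    have e : ∫⁻ x, ‖f x - f (x + h)‖ₑ ^ q =
        eLpNorm (fun x => f (x + h) - f x) (ENNReal.ofReal q) volume ^ q := by
      rw [eLpNorm_ofReal_rpow hq0]
      congr 1; funext x
      rw [← enorm_neg, neg_sub]
    have b1 : eLpNorm (fun x => f (x + h) - f x) (ENNReal.ofReal q) volume ≤ ‖h‖ₑ * A := by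
      refine (eLpNorm_translate_sub_le hq hn hg h).trans ?_
      gcongr
      rw [hA, two_mul]
      exact le_add_self.trans le_self_add
    have b2 : eLpNorm (fun x => f (x + h) - f x) (ENNReal.ofReal q) volume ≤ A := by
      have hmp := measurePreserving_add_right (volume : Measure (Rn n)) h
      have hfh : AEStronglyMeasurable (fun x => f (x + h)) volume :=
        hf.aestronglyMeasurable.comp_quasiMeasurePreserving hmp.quasiMeasurePreserving
      refine (eLpNorm_sub_le hfh hf.aestronglyMeasurable (by simpa using hq)).trans ?_
      have : eLpNorm (fun x => f (x + h)) (ENNReal.ofReal q) volume =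
          eLpNorm f (ENNReal.ofReal q) volume :=
        eLpNorm_comp_measurePreserving hf.aestronglyMeasurable hmp
      rw [this, hA, mul_add, two_mul]
      exact le_self_add
    rw [e]
    rcases le_total (‖h‖ₑ ^ q) 1 with hh | hh
    · rw [min_eq_left hh, ← ENNReal.mul_rpow_of_nonneg _ _ hq0.le]
      exact ENNReal.rpow_le_rpow b1 hq0.le
    · rw [min_eq_right hh, one_mul]
      exact ENNReal.rpow_le_rpow b2 hq0.le
  have hK := aemeasurable_slobodeckij_kernel hf.aestronglyMeasurable q ((n : ℝ) + θ * q)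
  rw [Measure.volume_eq_prod] at hK
  have hmp := measurePreserving_prod_add (volume : Measure (Rn n)) (volume : Measure (Rn n))
  have hslob : slobodeckij θ q f ^ q ≤ I * A ^ q := by
    rw [slobodeckij_rpow θ hq0, Measure.volume_eq_prod]
    conv_lhs => rw [← hmp.map_eq]
    rw [lintegral_map' (by rw [hmp.map_eq]; exact hK) hmp.measurable.aemeasurable]
    refine (lintegral_prod_symm _
      (hK.comp_quasiMeasurePreserving hmp.quasiMeasurePreserving)).trans_le ?_
    calc _ ≤ ∫⁻ h : Rn n, min (‖h‖ₑ ^ q) 1 / ‖h‖ₑ ^ ((n : ℝ) + θ * q) * A ^ q := by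
          refine lintegral_mono fun h => ?_
          simp only [Function.comp_apply, sub_add_cancel_left, enorm_neg, div_eq_mul_inv]
          rcases eq_or_ne h 0 with rfl | hh
          · simp [hq0]
          have ht : (‖h‖ₑ ^ ((n : ℝ) + θ * q))⁻¹ ≠ ⊤ := by
            rw [Ne, ENNReal.inv_eq_top, ENNReal.rpow_eq_zero_iff]
            simp [hh]
          rw [lintegral_mul_const' _ _ ht, mul_right_comm]
          gcongr
          exact hdiff h
      _ = I * A ^ q := by
          rw [lintegral_mul_const'']
          have : Measurable fun h : Rn n => ‖h‖ₑ := measurable_enorm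
          exact (((this.pow_const q).min measurable_const).div (this.pow_const _)).aemeasurable
  calc slobodeckij θ q f = (slobodeckij θ q f ^ q) ^ (1 / q) := by
        rw [← ENNReal.rpow_mul, mul_one_div_cancel hq0.ne', ENNReal.rpow_one]
    _ ≤ (I * A ^ q) ^ (1 / q) := by gcongr
    _ = _ := by
        rw [ENNReal.mul_rpow_of_nonneg _ _ (by positivity), ← ENNReal.rpow_mul A,
          mul_one_div_cancel hq0.ne', ENNReal.rpow_one, hA]
        ring

/-- The Gagliardo-Nirenberg-Sobolev inequality for smooth functions without support condition. -/
theorem eLpNorm_le_fderiv_of_contDiff {q m : ℝ} (hq : 1 ≤ q) (hn : 0 < n) (hm : 0 < m)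
    (h : 1 / m = 1 / q - 1 / n) : ∃ C : ℝ≥0∞, C ≠ ⊤ ∧ ∀ w : Rn n → ℝ, ContDiff ℝ ∞ w →
      eLpNorm w (ENNReal.ofReal m) volume ≤ C * (eLpNorm w (ENNReal.ofReal q) volume +
        eLpNorm (fderiv ℝ w) (ENNReal.ofReal q) volume) := by
  have hq0 : 0 < q := by linarith
  let χ : ContDiffBump (0 : Rn n) := ⟨1, 2, one_pos, one_lt_two⟩
  obtain ⟨B, hB⟩ : ∃ B : ℝ, ∀ x, ‖fderiv ℝ χ x‖ ≤ B := by
    have hc : Continuous (fderiv ℝ χ) := (χ.contDiff (n := 1)).continuous_fderiv (by simp)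
    exact hc.bounded_above_of_compact_support (χ.hasCompactSupport.fderiv ℝ)
  have hB0 : 0 ≤ B := (norm_nonneg _).trans (hB 0)
  set S : ℝ≥0∞ := ENNReal.ofNNReal
    (SNormLESNormFDerivOfEqConst ℝ (volume : Measure (Rn n)) q)
    with hS
  refine ⟨S * (1 + ENNReal.ofReal B), ENNReal.mul_ne_top (by simp [hS]) (by simp),
    fun w hw => ?_⟩
  have hwd := hw.continuous_fderiv (by simp : (∞ : WithTop ℕ∞) ≠ 0)
  set W : ℕ → Rn n → ℝ := fun k x => χ (((k : ℝ) + 1)⁻¹ • x) * w x with hW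
  have hWs : ∀ k, ContDiff ℝ ∞ (W k) := fun k =>
    (χ.contDiff.comp (contDiff_const_smul _)).mul hw
  have hWc : ∀ k, HasCompactSupport (W k) := fun k =>
    (χ.hasCompactSupport.comp_smul (inv_ne_zero (by positivity))).mul_right
  have hWd : ∀ k x, ‖fderiv ℝ (W k) x‖ ≤ ‖fderiv ℝ w x‖ + B * ‖w x‖ := by
    intro k x
    set c : ℝ := ((k : ℝ) + 1)⁻¹ with hc
    have hc1 : ‖c‖ ≤ 1 := by
      rw [Real.norm_of_nonneg (by positivity)]
      exact inv_le_one_of_one_le₀ (by linarith [(Nat.cast_nonneg k : (0 : ℝ) ≤ k)])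
    have h1 : HasFDerivAt (fun x : Rn n => χ (c • x))
        ((fderiv ℝ χ (c • x)).comp (c • ContinuousLinearMap.id ℝ (Rn n))) x :=
      ((χ.contDiff (n := 1)).differentiable (by simp) (c • x)).hasFDerivAt.comp x
        ((hasFDerivAt_id x).const_smul c)
    have h2 := (h1.mul (hw.differentiable (by simp) x).hasFDerivAt).fderiv
    rw [show W k = (fun x : Rn n => χ (c • x)) * w from rfl, h2]
    refine (norm_add_le _ _).trans (add_le_add ?_ ?_)
    · rw [norm_smul]
      refine mul_le_of_le_one_left (norm_nonneg _) ?_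
      rw [Real.norm_of_nonneg χ.nonneg]
      exact χ.le_one
    · rw [norm_smul, mul_comm]
      refine mul_le_mul_of_nonneg_right ?_ (norm_nonneg _)
      rw [ContinuousLinearMap.comp_smul, norm_smul, ContinuousLinearMap.comp_id]
      exact (mul_le_of_le_one_left (norm_nonneg _) hc1).trans (hB _)
  refine Lp.eLpNorm_le_of_ae_tendsto (u := atTop) (f := W) (Eventually.of_forall fun k => ?_)
    (fun k => (hWs k).continuous.aestronglyMeasurable) (Eventually.of_forall fun x => ?_)
  · have hgns := eLpNorm_le_eLpNorm_fderiv_of_eq (volume : Measure (Rn n)) ((hWs k).of_le (by simp))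
      (hWc k) (p := q.toNNReal) (p' := m.toNNReal) (by simpa using hq) (by simpa using hn)
      (by
        simp only [finrank_euclideanSpace_fin, NNReal.coe_inv, Real.coe_toNNReal _ hm.le,
          Real.coe_toNNReal _ hq0.le]
        simpa [one_div] using h)
    rw [Real.coe_toNNReal _ hq0.le] at hgns
    refine hgns.trans ?_
    rw [mul_assoc]
    have h3 : eLpNorm (fderiv ℝ (W k)) (ENNReal.ofReal q) volume ≤
        eLpNorm (fderiv ℝ w) (ENNReal.ofReal q) volume +
        ENNReal.ofReal B * eLpNorm w (ENNReal.ofReal q) volume := by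
      calc _ ≤ eLpNorm ((fun x => ‖fderiv ℝ w x‖) + fun x => B * ‖w x‖)
            (ENNReal.ofReal q) volume := eLpNorm_mono_real (hWd k)
        _ ≤ _ := eLpNorm_add_le hwd.norm.aestronglyMeasurable
            (hw.continuous.norm.const_mul B |>.aestronglyMeasurable) (by simpa using hq)
        _ = _ := by
            rw [eLpNorm_norm, show (fun x => B * ‖w x‖) = B • (fun x => ‖w x‖) from rfl,
              eLpNorm_const_smul, eLpNorm_norm, Real.enorm_eq_ofReal hB0]
    refine mul_le_mul' le_rfl (h3.trans ?_)
    rw [add_mul, one_mul, mul_add]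
    exact add_le_add le_add_self le_self_add
  · have h1 : Tendsto (fun k : ℕ => (((k : ℝ) + 1)⁻¹ • x : Rn n)) atTop (nhds ((0 : ℝ) • x)) :=
      (by simpa [one_div] using tendsto_one_div_add_atTop_nhds_zero_nat (𝕜 := ℝ) :
        Tendsto (fun k : ℕ => ((k : ℝ) + 1)⁻¹) atTop (nhds 0)).smul_const x
    rw [zero_smul] at h1
    have h2 := ((χ.contDiff (n := 0)).continuous.tendsto 0).comp h1
    rw [χ.one_of_mem_closedBall (by simp [χ])] at h2
    simpa using h2.mul_const (w x)

/-- The first-order Sobolev embedding `W^{1,q} ⊆ L^m` for finite `m`. -/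
theorem eLpNorm_le_of_isWeakPartial (hn : 0 < n) {q m : ℝ} (hq : 1 ≤ q) (hqm : q ≤ m)
    (h : 1 / q - 1 / n ≤ 1 / m) : ∃ C : ℝ≥0∞, C ≠ ⊤ ∧
      ∀ (f : Rn n → ℝ) (g : Fin n → Rn n → ℝ), (∀ i, IsWeakPartial i f (g i)) →
        eLpNorm f (ENNReal.ofReal q) volume ≠ ⊤ → eLpNorm f (ENNReal.ofReal m) volume ≤
        C * (eLpNorm f (ENNReal.ofReal q) volume +
          ∑ i, eLpNorm (g i) (ENNReal.ofReal q) volume) := by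
  have hq0 : 0 < q := by linarith
  have hm0 : 0 < m := by linarith
  have hn' : (0 : ℝ) < n := by exact_mod_cast hn
  rcases eq_or_lt_of_le h with heq | hlt
  · -- the critical exponent
    obtain ⟨C, hC, H⟩ := eLpNorm_le_fderiv_of_contDiff hq hn hm0 heq.symm
    refine ⟨C, hC, fun f g hg _ => ?_⟩
    have hf : LocallyIntegrable f := (hg ⟨0, hn⟩).1
    refine Lp.eLpNorm_le_of_ae_tendsto (u := atTop) (f := fun j => moll j f)
      (Eventually.of_forall fun j => ?_)
      (fun j => (moll_contDiff j hf).continuous.aestronglyMeasurable) (moll_ae_tendsto hf)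
    refine (H _ (moll_contDiff j hf)).trans (mul_le_mul' le_rfl (add_le_add ?_ ?_))
    · exact eLpNorm_moll_le j (by simpa using hq) hf.aestronglyMeasurable
    · exact eLpNorm_fderiv_moll_le j hq hg
  · obtain ⟨θ, hθ0, hθ1, hθ⟩ : ∃ θ : ℝ, 0 < θ ∧ θ < 1 ∧ 1 / q - θ / n ≤ 1 / m := by
      refine ⟨max (1 / 2) (n * (1 / q - 1 / m)), by positivity, max_lt (by norm_num) ?_, ?_⟩
      · have : n * (1 / q - 1 / m) < n * (1 / n) := by gcongr; linarith
        rwa [mul_one_div_cancel hn'.ne'] at this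
      · have : n * (1 / q - 1 / m) / n ≤ max (1 / 2) (n * (1 / q - 1 / m)) / n := by
          gcongr; exact le_max_right _ _
        rw [mul_div_cancel_left₀ _ hn'.ne'] at this
        linarith
    obtain ⟨C, hC, H⟩ := eLpNorm_le_slobodeckij hn hθ0.le hq hqm hθ
    obtain ⟨C', hC', H'⟩ := slobodeckij_le_of_isWeakPartial hn hθ0 hθ1 hq
    refine ⟨C * (1 + C'), ENNReal.mul_ne_top hC (by simp [hC']), fun f g hg hfq => ?_⟩
    have hf : LocallyIntegrable f := (hg ⟨0, hn⟩).1
    refine (H f hf.aestronglyMeasurable hfq).trans ?_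
    rw [mul_assoc]
    refine mul_le_mul' le_rfl ?_
    rw [add_mul, one_mul]
    exact add_le_add le_self_add (H' f g hg)

/-- The first-order embedding `W^{1,q} ⊆ L^∞` for `q > n`. -/
theorem eLpNorm_top_le_of_isWeakPartial (hn : 0 < n) {q : ℝ} (hq : 1 ≤ q) (hqn : n < q) :
    ∃ C : ℝ≥0∞, C ≠ ⊤ ∧
      ∀ (f : Rn n → ℝ) (g : Fin n → Rn n → ℝ), (∀ i, IsWeakPartial i f (g i)) →
        eLpNorm f ⊤ volume ≤ C * (eLpNorm f (ENNReal.ofReal q) volume +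
          ∑ i, eLpNorm (g i) (ENNReal.ofReal q) volume) := by
  have hq0 : 0 < q := by linarith
  have hn' : (0 : ℝ) < n := by exact_mod_cast hn
  have h1 : n / q < 1 := (div_lt_one hq0).2 hqn
  have h0 : 0 < n / q := by positivity
  obtain ⟨C, hC, H⟩ := eLpNorm_top_le_slobodeckij (n := n) (θ := (1 + n / q) / 2) (by linarith) hq
    (by linarith)
  obtain ⟨C', hC', H'⟩ := slobodeckij_le_of_isWeakPartial hn (θ := (1 + n / q) / 2)
    (by linarith) (by linarith) hq
  refine ⟨C * (1 + C'), ENNReal.mul_ne_top hC (by simp [hC']), fun f g hg => ?_⟩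
  refine (H f (hg ⟨0, hn⟩).1).trans ?_
  rw [mul_assoc]
  refine mul_le_mul' le_rfl ?_
  rw [add_mul, one_mul]
  exact add_le_add le_self_add (H' f g hg)

/-! ### Weak derivatives of higher order -/

theorem partialD_comm (i j : Fin n) {f : Rn n → ℝ} (hf : ContDiff ℝ ∞ f) :
    partialD i (partialD j f) = partialD j (partialD i f) := by
  have h : ∀ a b : Fin n, ∀ x, partialD a (partialD b f) x =
      fderiv ℝ (fderiv ℝ f) x (EuclideanSpace.single a 1) (EuclideanSpace.single b 1) := by
    intro a b x
    have hd : DifferentiableAt ℝ (fderiv ℝ f) x :=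
      (hf.fderiv_right (m := ∞) (by simp)).differentiable (by simp) x
    have := (hd.hasFDerivAt.clm_apply
      (hasFDerivAt_const (EuclideanSpace.single b (1 : ℝ)) x)).fderiv
    rw [partialD, show partialD b f = fun y => fderiv ℝ f y (EuclideanSpace.single b 1) from rfl,
      this]
    simp
  funext x
  rw [h, h]
  exact (hf.contDiffAt.isSymmSndFDerivAt (by
    rw [minSmoothness_of_isRCLikeNormedField]; exact WithTop.coe_le_coe.2 le_top)) _ _

theorem contDiff_iterate_partialD (i : Fin n) (k : ℕ) {f : Rn n → ℝ} (hf : ContDiff ℝ ∞ f) :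
    ContDiff ℝ ∞ ((partialD i)^[k] f) := by
  induction k generalizing f with
  | zero => exact hf
  | succ k ih => exact ih (partialD_smooth i hf)

theorem iterate_partialD_comm (i j : Fin n) (k : ℕ) {f : Rn n → ℝ} (hf : ContDiff ℝ ∞ f) :
    (partialD i)^[k] (partialD j f) = partialD j ((partialD i)^[k] f) := by
  induction k generalizing f with
  | zero => rfl
  | succ k ih =>
    rw [Function.iterate_succ_apply, Function.iterate_succ_apply, partialD_comm i j hf,
      ih (partialD_smooth i hf)]

theorem contDiff_foldr_partialD (l : List (Fin n)) (ν : Fin n → ℕ) {f : Rn n → ℝ}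
    (hf : ContDiff ℝ ∞ f) :
    ContDiff ℝ ∞ (l.foldr (fun i g => (partialD i)^[ν i] g) f) := by
  induction l with
  | nil => exact hf
  | cons a l ih => exact contDiff_iterate_partialD a _ ih

theorem multiD_partialD (ν : Fin n → ℕ) (i : Fin n) {f : Rn n → ℝ} (hf : ContDiff ℝ ∞ f) :
    multiD ν (partialD i f) = partialD i (multiD ν f) := by
  unfold multiD
  induction List.finRange n with
  | nil => rfl
  | cons a l ih =>
    rw [List.foldr_cons, List.foldr_cons, ih,
      iterate_partialD_comm _ _ _ (contDiff_foldr_partialD l ν hf)]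

theorem multiD_add_single (ν : Fin n → ℕ) (i : Fin n) {f : Rn n → ℝ} (hf : ContDiff ℝ ∞ f) :
    multiD (ν + Pi.single i 1) f = partialD i (multiD ν f) := by
  unfold multiD
  have key : ∀ l : List (Fin n), l.Nodup →
      l.foldr (fun j g => (partialD j)^[(ν + Pi.single i 1 : Fin n → ℕ) j] g) f =
        if i ∈ l then partialD i (l.foldr (fun j g => (partialD j)^[ν j] g) f)
        else l.foldr (fun j g => (partialD j)^[ν j] g) f := by
    intro l
    induction l with
    | nil => simp
    | cons a l ih =>
      intro hl
      rw [List.nodup_cons] at hl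
      rw [List.foldr_cons, List.foldr_cons, ih hl.2]
      rcases eq_or_ne a i with rfl | hai
      · rw [if_neg hl.1, if_pos (by simp), ← Function.iterate_succ_apply' (partialD a)]
        simp
      · have h1 : (ν + Pi.single i 1 : Fin n → ℕ) a = ν a := by simp [hai]
        rw [h1]
        by_cases hil : i ∈ l
        · rw [if_pos hil, if_pos (by simp [hil]),
            iterate_partialD_comm _ _ _ (contDiff_foldr_partialD l ν hf)]
        · rw [if_neg hil, if_neg (by simp [hil, hai.symm])]
  rw [key _ (List.nodup_finRange n), if_pos (List.mem_finRange i)]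

theorem sum_add_single (ν : Fin n → ℕ) (i : Fin n) :
    ∑ j, (ν + Pi.single i 1 : Fin n → ℕ) j = ∑ j, ν j + 1 := by
  simp [Finset.sum_add_distrib]

theorem IsWeakDeriv.isWeakPartial {ν : Fin n → ℕ} {i : Fin n} {u w w' : Rn n → ℝ}
    (h : IsWeakDeriv ν u w) (h' : IsWeakDeriv (ν + Pi.single i 1) u w') :
    IsWeakPartial i w w' := by
  refine ⟨h.2.1, h'.2.1, fun φ hφ hc => ?_⟩
  have e1 := h.2.2 _ (partialD_smooth i hφ) (partialD_compact i hc)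
  have e2 := h'.2.2 φ hφ hc
  rw [multiD_partialD ν i hφ, ← multiD_add_single ν i hφ, e2, sum_add_single, pow_succ] at e1
  have hne : ((-1 : ℝ) ^ ∑ j, ν j) ≠ 0 := pow_ne_zero _ (by norm_num)
  refine mul_left_cancel₀ hne ?_
  rw [← e1]
  ring

theorem IsWeakPartial.isWeakDeriv_add_single {ν : Fin n → ℕ} {i : Fin n} {f g w : Rn n → ℝ}
    (h : IsWeakPartial i f g) (h' : IsWeakDeriv ν g w) :
    IsWeakDeriv (ν + Pi.single i 1) f w := by
  refine ⟨h.1, h'.2.1, fun φ hφ hc => ?_⟩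
  obtain ⟨hs, hcs⟩ := multiD_test ν hφ hc
  rw [multiD_add_single ν i hφ, h.2.2 _ hs hcs, h'.2.2 φ hφ hc, sum_add_single, pow_succ]
  ring

theorem isWeakDeriv_zero {u : Rn n → ℝ} (hu : LocallyIntegrable u) : IsWeakDeriv 0 u u := by
  refine ⟨hu, hu, fun φ _ _ => ?_⟩
  have h' : multiD 0 φ = φ := by
    unfold multiD
    induction List.finRange n with
    | nil => rfl
    | cons i l ih => exact ih
  simp [h']

/-- The Leibniz rule, in the form of a bound. The derivative is peeled off one coordinate direction
at a time, and each step replaces one product by two; this avoids binomial coefficients. -/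
theorem exists_isWeakDeriv_mul {s : ℕ} {p K : ℝ≥0∞} (hp : 1 ≤ p)
    {D₁ D₂ : (Fin n → ℕ) → Rn n → ℝ}
    (h₁ : ∀ α i, ∑ j, α j < s → IsWeakPartial i (D₁ α) (D₁ (α + Pi.single i 1)))
    (h₂ : ∀ α i, ∑ j, α j < s → IsWeakPartial i (D₂ α) (D₂ (α + Pi.single i 1)))
    (hK : ∀ α β, ∑ j, α j + ∑ j, β j ≤ s → ∃ a b : ℝ≥0∞, ENNReal.HolderTriple a b p ∧
      MemLp (D₁ α) a volume ∧ MemLp (D₂ β) b volume ∧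
      eLpNorm (D₁ α) a volume * eLpNorm (D₂ β) b volume ≤ K)
    (m : ℕ) (ν α β : Fin n → ℕ) (hν : ∑ j, ν j = m)
    (hs : m + (∑ j, α j + ∑ j, β j) ≤ s) :
    ∃ w, IsWeakDeriv ν (D₁ α * D₂ β) w ∧ eLpNorm w p volume ≤ 2 ^ m * K := by
  induction m generalizing ν α β with
  | zero =>
    have hν0 : ν = 0 := by
      funext j
      exact Finset.sum_eq_zero_iff.1 hν j (Finset.mem_univ j)
    subst hν0
    obtain ⟨a, b, t, ha, hb, hab⟩ := hK α β (by omega)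
    refine ⟨_, isWeakDeriv_zero ((hb.mul (r := p) ha).locallyIntegrable hp), ?_⟩
    rw [pow_zero, one_mul]
    exact (eLpNorm_smul_le_mul_eLpNorm (r := p) hb.1 ha.1).trans hab
  | succ m ih =>
    obtain ⟨i, hi⟩ : ∃ i, ν i ≠ 0 := by
      by_contra! h0
      simp [h0] at hν
    set ν' : Fin n → ℕ := ν - Pi.single i 1 with hν'
    have hνν' : ν = ν' + Pi.single i 1 := by
      funext j
      rcases eq_or_ne j i with rfl | hj
      · simp [hν']; omega
      · simp [hν', hj]
    have hsum : ∑ j, ν' j = m := by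
      rw [hνν', sum_add_single] at hν; omega
    obtain ⟨a₀, b₀, t₀, ha₀, hb₀, -⟩ := hK α β (by omega)
    obtain ⟨a₁, b₁, t₁, ha₁, hb₁, -⟩ := hK (α + Pi.single i 1) β (by rw [sum_add_single]; omega)
    obtain ⟨a₂, b₂, t₂, ha₂, hb₂, -⟩ := hK α (β + Pi.single i 1) (by rw [sum_add_single]; omega)
    have hprod := (h₁ α i (by omega)).mul (h₂ β i (by omega)) hp ha₀ hb₀ ha₁ hb₁ ha₂ hb₂
    obtain ⟨w₁, hw₁, hb₁⟩ := ih ν' (α + Pi.single i 1) β hsum (by rw [sum_add_single]; omega)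
    obtain ⟨w₂, hw₂, hb₂⟩ := ih ν' α (β + Pi.single i 1) hsum (by rw [sum_add_single]; omega)
    refine ⟨w₁ + w₂, ?_, ?_⟩
    · rw [hνν']
      exact hprod.isWeakDeriv_add_single (hw₁.add hw₂)
    · refine (eLpNorm_add_le hw₁.2.1.aestronglyMeasurable hw₂.2.1.aestronglyMeasurable hp).trans ?_
      refine (add_le_add hb₁ hb₂).trans_eq ?_
      ring

/-! ### Embeddings for families of derivatives -/

/-- The family `D α`, `|α| ≤ k`, behaves like the derivatives of a function whose norm in
`W^{k+θ,q}` is at most `A`: each function is a weak derivative of its predecessors, and the `L^q`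
norms, together with the Slobodeckij seminorms of the top order if `θ ≠ 0`, are at most `A`. -/
structure IsSobolevFamily (k : ℕ) (θ q : ℝ) (D : (Fin n → ℕ) → Rn n → ℝ) (A : ℝ≥0∞) : Prop where
  locallyIntegrable : ∀ α, ∑ j, α j ≤ k → LocallyIntegrable (D α)
  isWeakPartial : ∀ α i, ∑ j, α j < k → IsWeakPartial i (D α) (D (α + Pi.single i 1))
  eLpNorm_le : ∀ α, ∑ j, α j ≤ k → eLpNorm (D α) (ENNReal.ofReal q) volume ≤ A
  slobodeckij_le : θ ≠ 0 → ∀ α, ∑ j, α j = k → slobodeckij θ q (D α) ≤ A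

namespace IsSobolevFamily

variable {k : ℕ} {θ q : ℝ} {D : (Fin n → ℕ) → Rn n → ℝ} {A : ℝ≥0∞}

theorem norm_add_sum_le (h : IsSobolevFamily k θ q D A) {α : Fin n → ℕ} (hα : ∑ j, α j < k) :
    eLpNorm (D α) (ENNReal.ofReal q) volume +
      ∑ i, eLpNorm (D (α + Pi.single i 1)) (ENNReal.ofReal q) volume ≤ (1 + n) * A := by
  rw [add_mul, one_mul]
  refine add_le_add (h.eLpNorm_le α hα.le) ?_
  refine (Finset.sum_le_card_nsmul _ _ A fun i _ => h.eLpNorm_le _ ?_).trans ?_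
  · rw [sum_add_single]; omega
  · simp

theorem mono_order (h : IsSobolevFamily k θ q D A) {k' : ℕ} (hk : k' ≤ k) :
    IsSobolevFamily k' 0 q D A where
  locallyIntegrable α hα := h.locallyIntegrable α (hα.trans hk)
  isWeakPartial α i hα := h.isWeakPartial α i (hα.trans_le hk)
  eLpNorm_le α hα := h.eLpNorm_le α (hα.trans hk)
  slobodeckij_le h0 := absurd rfl h0

end IsSobolevFamily

/-- A gain of integrability at the cost of one derivative. -/
theorem exists_isSobolevFamily_succ (hn : 0 < n) (k : ℕ) {q m : ℝ} (hq : 1 ≤ q) (hqm : q ≤ m)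
    (h : 1 / q - 1 / n ≤ 1 / m) : ∃ C : ℝ≥0∞, C ≠ ⊤ ∧
      ∀ (D : (Fin n → ℕ) → Rn n → ℝ) (A : ℝ≥0∞), A ≠ ⊤ → IsSobolevFamily (k + 1) 0 q D A →
        IsSobolevFamily k 0 m D (C * A) := by
  obtain ⟨C, hC, H⟩ := eLpNorm_le_of_isWeakPartial hn hq hqm h
  refine ⟨C * (1 + n), ENNReal.mul_ne_top hC (by simp), fun D A hA hD => ?_⟩
  refine ⟨(hD.mono_order (Nat.le_succ k)).locallyIntegrable,
    (hD.mono_order (Nat.le_succ k)).isWeakPartial, fun α hα => ?_, fun h0 => absurd rfl h0⟩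
  have hα' : ∑ j, α j < k + 1 := by omega
  refine (H _ _ (fun i => hD.isWeakPartial α i hα')
    (ne_top_of_le_ne_top hA (hD.eLpNorm_le α hα'.le))).trans ?_
  rw [mul_assoc]
  exact mul_le_mul' le_rfl (hD.norm_add_sum_le hα')

theorem exists_isSobolevFamily_add (hn : 0 < n) (k d : ℕ) {q m : ℝ} (hq : 1 ≤ q) (hqm : q ≤ m)
    (h : 1 / q - d / n ≤ 1 / m) : ∃ C : ℝ≥0∞, C ≠ ⊤ ∧
      ∀ (D : (Fin n → ℕ) → Rn n → ℝ) (A : ℝ≥0∞), A ≠ ⊤ → IsSobolevFamily (k + d) 0 q D A →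
        IsSobolevFamily k 0 m D (C * A) := by
  have hn' : (0 : ℝ) < n := by exact_mod_cast hn
  induction d generalizing q with
  | zero =>
    have hm : m = q := by
      refine le_antisymm ?_ hqm
      rw [Nat.cast_zero, zero_div, sub_zero] at h
      exact (one_div_le_one_div (by linarith) (by linarith)).1 h
    subst hm
    exact ⟨1, by simp, fun D A _ hD => by simpa using hD⟩
  | succ d ih =>
    have hq0 : 0 < q := by linarith
    have hm0 : 0 < m := by linarith
    have hmq : 1 / m ≤ 1 / q := one_div_le_one_div_of_le hq0 hqm
    -- the intermediate exponent `1 / r`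
    set r : ℝ := max (1 / m) (1 / q - 1 / n) with hr
    have hr0 : 0 < r := (one_div_pos.2 hm0).trans_le (le_max_left _ _)
    have hrq : r ≤ 1 / q := max_le hmq (by linarith [one_div_pos.2 hn'])
    have h1 : q ≤ 1 / r := (le_one_div hq0 hr0).2 hrq
    obtain ⟨C₁, hC₁, H₁⟩ := exists_isSobolevFamily_succ hn (k + d) (m := 1 / r) hq h1
      (by rw [one_div_one_div]; exact le_max_right _ _)
    obtain ⟨C₂, hC₂, H₂⟩ := ih (q := 1 / r) (hq.trans h1)
      ((one_div_le hr0 hm0).2 (le_max_left _ _)) (by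
        rw [one_div_one_div]
        have hd : (0 : ℝ) ≤ d / n := by positivity
        have : r ≤ 1 / m + d / n := by
          refine max_le (by linarith) ?_
          push_cast at h
          rw [add_div] at h
          linarith
        linarith)
    refine ⟨C₂ * C₁, ENNReal.mul_ne_top hC₂ hC₁, fun D A hA hD => ?_⟩
    rw [mul_assoc]
    exact H₂ D _ (ENNReal.mul_ne_top hC₁ hA) (H₁ D A hA hD)

/-- The Sobolev embedding into `L^m` for finite `m`, for the derivatives of order `k` of a function
of smoothness `k + d + θ`. -/
theorem exists_eLpNorm_le (hn : 0 < n) (k d : ℕ) {θ q m : ℝ} (hθ0 : 0 ≤ θ) (hθ1 : θ < 1)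
    (hq : 1 ≤ q) (hqm : q ≤ m) (h : 1 / q - (d + θ) / n ≤ 1 / m) : ∃ C : ℝ≥0∞, C ≠ ⊤ ∧
      ∀ (D : (Fin n → ℕ) → Rn n → ℝ) (A : ℝ≥0∞), A ≠ ⊤ → IsSobolevFamily (k + d) θ q D A →
        IsSobolevFamily k 0 m D (C * A) := by
  have hn' : (0 : ℝ) < n := by exact_mod_cast hn
  rcases eq_or_ne θ 0 with rfl | hθ
  · exact exists_isSobolevFamily_add hn k d hq hqm (by simpa using h)
  have hq0 : 0 < q := by linarith
  have hm0 : 0 < m := by linarith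
  have hmq : 1 / m ≤ 1 / q := one_div_le_one_div_of_le hq0 hqm
  set r : ℝ := max (1 / m) (1 / q - θ / n) with hr
  have hr0 : 0 < r := (one_div_pos.2 hm0).trans_le (le_max_left _ _)
  have hθn : 0 ≤ θ / n := by positivity
  have hrq : r ≤ 1 / q := max_le hmq (by linarith)
  have h1 : q ≤ 1 / r := (le_one_div hq0 hr0).2 hrq
  obtain ⟨C₁, hC₁, H₁⟩ := eLpNorm_le_slobodeckij hn hθ0 hq h1
    (by rw [one_div_one_div]; exact le_max_right _ _)
  obtain ⟨C₂, hC₂, H₂⟩ := eLpNorm_le_of_isWeakPartial hn hq h1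
    (by
      rw [one_div_one_div]
      refine le_trans ?_ (le_max_right _ _)
      gcongr)
  obtain ⟨C₃, hC₃, H₃⟩ := exists_isSobolevFamily_add hn k d (q := 1 / r) (hq.trans h1)
    ((one_div_le hr0 hm0).2 (le_max_left _ _)) (by
      rw [one_div_one_div]
      have hd : (0 : ℝ) ≤ d / n := by positivity
      have : r ≤ 1 / m + d / n := by
        refine max_le (by linarith) ?_
        rw [add_div] at h
        linarith
      linarith)
  set C : ℝ≥0∞ := C₁ * 2 + C₂ * (1 + n) with hC
  have hCt : C ≠ ⊤ := by
    simp only [hC, Ne, ENNReal.add_eq_top, not_or]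
    exact ⟨ENNReal.mul_ne_top hC₁ (by simp), ENNReal.mul_ne_top hC₂ (by simp)⟩
  refine ⟨C₃ * C, ENNReal.mul_ne_top hC₃ hCt, fun D A hA hD => ?_⟩
  rw [mul_assoc]
  refine H₃ D _ (ENNReal.mul_ne_top hCt hA)
    ⟨hD.locallyIntegrable, hD.isWeakPartial, fun α hα => ?_, fun h0 => absurd rfl h0⟩
  have hfin := ne_top_of_le_ne_top hA (hD.eLpNorm_le α hα)
  rw [hC, add_mul]
  rcases hα.eq_or_lt with heq | hlt
  · refine le_trans ?_ le_self_add
    refine (H₁ _ (hD.locallyIntegrable α hα).aestronglyMeasurable hfin).trans ?_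
    rw [mul_assoc, two_mul]
    exact mul_le_mul' le_rfl (add_le_add (hD.eLpNorm_le α hα) (hD.slobodeckij_le hθ α heq))
  · refine le_trans ?_ le_add_self
    refine (H₂ _ _ (fun i => hD.isWeakPartial α i hlt) hfin).trans ?_
    rw [mul_assoc]
    exact mul_le_mul' le_rfl (hD.norm_add_sum_le hlt)

/-- The Sobolev embedding into `L^∞`, for the derivatives of order `k` of a function of smoothness
`k + d + θ`. -/
theorem exists_eLpNorm_top_le (hn : 0 < n) (k d : ℕ) {θ q : ℝ} (hθ0 : 0 ≤ θ) (hθ1 : θ < 1)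
    (hq : 1 ≤ q) (h : n / q < d + θ) : ∃ C : ℝ≥0∞, C ≠ ⊤ ∧
      ∀ (D : (Fin n → ℕ) → Rn n → ℝ) (A : ℝ≥0∞), A ≠ ⊤ → IsSobolevFamily (k + d) θ q D A →
        ∀ α, ∑ j, α j = k → eLpNorm (D α) ⊤ volume ≤ C * A := by
  have hn' : (0 : ℝ) < n := by exact_mod_cast hn
  have hq0 : 0 < q := by linarith
  have hnq : 0 < n / q := by positivity
  rcases d with _ | d
  · simp only [Nat.cast_zero, zero_add] at h
    obtain ⟨C, hC, H⟩ := eLpNorm_top_le_slobodeckij hθ0 hq h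
    refine ⟨C * 2, ENNReal.mul_ne_top hC (by simp), fun D A hA hD α hα => ?_⟩
    have hα' : ∑ j, α j ≤ k + 0 := by omega
    refine (H _ (hD.locallyIntegrable α hα')).trans ?_
    rw [mul_assoc, two_mul]
    exact mul_le_mul' le_rfl (add_le_add (hD.eLpNorm_le α hα')
      (hD.slobodeckij_le (by linarith) α (by omega)))
  -- an exponent `1 / r > n` that the derivatives of order `k + 1` reach
  set r : ℝ := max (1 / q - (d + θ) / n) (min (1 / q) (1 / (2 * n))) with hr
  have hr0 : 0 < r := by
    refine lt_of_lt_of_le ?_ (le_max_right _ _)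
    positivity
  have hdθ : 0 ≤ (d + θ) / n := by positivity
  have hrq : r ≤ 1 / q := max_le (by linarith) (min_le_left _ _)
  have hrn : r < 1 / n := by
    refine max_lt ?_ ((min_le_right _ _).trans_lt ?_)
    · have h2 : n / q / n < ((d + 1 : ℕ) + θ) / n := by gcongr
      rw [show n / q / n = 1 / q by field_simp] at h2
      have h3 : (((d + 1 : ℕ) : ℝ) + θ) / n = (d + θ) / n + 1 / n := by
        push_cast; ring
      linarith
    · exact one_div_lt_one_div_of_lt hn' (by linarith)
  have h1 : q ≤ 1 / r := (le_one_div hq0 hr0).2 hrq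
  obtain ⟨C₁, hC₁, H₁⟩ := exists_eLpNorm_le hn (k + 1) d (m := 1 / r) hθ0 hθ1 hq h1
    (by rw [one_div_one_div]; exact le_max_left _ _)
  obtain ⟨C₂, hC₂, H₂⟩ := eLpNorm_top_le_of_isWeakPartial hn (q := 1 / r) (hq.trans h1)
    ((lt_one_div hn' hr0).2 hrn)
  refine ⟨C₂ * ((1 + n) * C₁), ENNReal.mul_ne_top hC₂ (ENNReal.mul_ne_top (by simp) hC₁),
    fun D A hA hD α hα => ?_⟩
  rw [show k + (d + 1) = (k + 1) + d by ring] at hD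
  have hD' := H₁ D A hA hD
  refine (H₂ _ _ (fun i => hD'.isWeakPartial α i (by omega))).trans ?_
  rw [mul_assoc, mul_assoc]
  exact mul_le_mul' le_rfl (hD'.norm_add_sum_le (by omega))

/-- Both embeddings at once, with target `L^a` where `1 / a = x`. -/
theorem exists_eLpNorm_inv_le (hn : 0 < n) {σ q x : ℝ} {k : ℕ} (hk : (k : ℝ) ≤ σ) (hq : 1 ≤ q)
    (hx0 : 0 ≤ x) (hxq : x ≤ 1 / q) (hx : 1 / q - (σ - k) / n ≤ x)
    (hxt : x = 0 → 1 / q - (σ - k) / n < 0) : ∃ C : ℝ≥0∞, C ≠ ⊤ ∧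
      ∀ (D : (Fin n → ℕ) → Rn n → ℝ) (A : ℝ≥0∞), A ≠ ⊤ →
        IsSobolevFamily ⌊σ⌋₊ (Int.fract σ) q D A →
        ∀ α, ∑ j, α j = k → eLpNorm (D α) (ENNReal.ofReal x)⁻¹ volume ≤ C * A := by
  have hn' : (0 : ℝ) < n := by exact_mod_cast hn
  have hσ0 : 0 ≤ σ := (Nat.cast_nonneg k).trans hk
  obtain ⟨d, hd⟩ := Nat.exists_eq_add_of_le (Nat.le_floor hk)
  have hσ : σ - k = d + Int.fract σ := by
    have h1 := Int.floor_add_fract σ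
    have h2 : ((⌊σ⌋₊ : ℕ) : ℝ) = ⌊σ⌋ := natCast_floor_eq_intCast_floor hσ0
    rw [hd] at h2
    push_cast at h2
    linarith
  rw [hσ] at hx hxt
  rw [hd]
  -- `x = 0` stands for the target `L^∞`, as `0⁻¹ = ∞` in `ℝ≥0∞`
  rcases hx0.eq_or_lt with rfl | hx0
  · obtain ⟨C, hC, H⟩ := exists_eLpNorm_top_le hn k d (Int.fract_nonneg σ) (Int.fract_lt_one σ) hq
      (by
        have h1 := hxt rfl
        have h2 : 1 / q < (d + Int.fract σ) / n := by linarith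
        rw [lt_div_iff₀ hn'] at h2
        calc n / q = 1 / q * n := by ring
          _ < _ := h2)
    exact ⟨C, hC, fun D A hA hD α hα => by simpa using H D A hA hD α hα⟩
  · obtain ⟨C, hC, H⟩ := exists_eLpNorm_le hn k d (m := 1 / x) (Int.fract_nonneg σ)
      (Int.fract_lt_one σ) hq ((le_one_div (by linarith) hx0).2 hxq)
      (by rw [one_div_one_div]; exact hx)
    refine ⟨C, hC, fun D A hA hD α hα => ?_⟩
    have := (H D A hA hD).eLpNorm_le α hα.le
    rwa [one_div, ENNReal.ofReal_inv_of_pos hx0] at this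

/-- The choice of the exponents in Hölder's inequality: `c₁, c₂, P` are the reciprocals of
`p₁, p₂, p`, and `aᵢ` is the reciprocal of the critical exponent for the `i`-th factor. -/
theorem exists_holder_exponents {P c₁ c₂ a₁ a₂ : ℝ} (hP : 0 < P) (hc₁ : 0 < c₁) (hc₂ : 0 < c₂)
    (hc : P ≤ c₁ + c₂) (ha₁ : a₁ ≤ c₁) (ha₂ : a₂ ≤ c₂)
    (h : (a₁ ≤ P ∧ a₂ ≤ P ∧ a₁ + a₂ < P) ∨ (a₁ < P ∧ a₂ < P ∧ a₁ + a₂ ≤ P)) :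
    ∃ x y : ℝ, x + y = P ∧ (0 ≤ x ∧ x ≤ c₁ ∧ a₁ ≤ x ∧ (x = 0 → a₁ < 0)) ∧
      (0 ≤ y ∧ y ≤ c₂ ∧ a₂ ≤ y ∧ (y = 0 → a₂ < 0)) := by
  obtain ⟨b₁, b₂, b₃⟩ : a₁ ≤ P ∧ a₂ ≤ P ∧ a₁ + a₂ ≤ P := by
    rcases h with h | h
    · exact ⟨h.1, h.2.1, h.2.2.le⟩
    · exact ⟨h.1.le, h.2.1.le, h.2.2⟩
  -- `x` is the midpoint of the interval `[l, u]` of all admissible values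
  obtain ⟨l, l₀, l₁, l₂, hl⟩ : ∃ l : ℝ, 0 ≤ l ∧ a₁ ≤ l ∧ P - c₂ ≤ l ∧
      (l = 0 ∨ l = a₁ ∨ l = P - c₂) := by
    refine ⟨max 0 (max a₁ (P - c₂)), by simp, by simp, by simp, ?_⟩
    rcases max_choice 0 (max a₁ (P - c₂)) with h | h
    · exact Or.inl h
    · rw [h]; exact Or.inr (max_choice _ _)
  obtain ⟨u, u₀, u₁, u₂, hu⟩ : ∃ u : ℝ, u ≤ P ∧ u ≤ c₁ ∧ u ≤ P - a₂ ∧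
      (u = P ∨ u = c₁ ∨ u = P - a₂) := by
    refine ⟨min P (min c₁ (P - a₂)), by simp, by simp, by simp, ?_⟩
    rcases min_choice P (min c₁ (P - a₂)) with h | h
    · exact Or.inl h
    · rw [h]; exact Or.inr (min_choice _ _)
  have hlu : l ≤ u := by
    rcases hl with rfl | rfl | rfl <;> rcases hu with rfl | rfl | rfl <;> linarith
  refine ⟨(l + u) / 2, P - (l + u) / 2, by ring,
    ⟨by linarith, by linarith, by linarith, fun h0 => ?_⟩,
    ⟨by linarith, by linarith, by linarith, fun h0 => ?_⟩⟩
  · have hu0 : u = 0 := by linarith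
    rcases hu with hu | hu | hu
    · linarith
    · linarith
    · rcases h with h | h <;> linarith [h.1, h.2.1, h.2.2]
  · have hlP : l = P := by linarith
    rcases hl with hl | hl | hl
    · linarith
    · rcases h with h | h <;> linarith [h.1, h.2.1, h.2.2]
    · linarith

/-! ### The multiplication estimate -/

theorem mem_multiIdx {m : ℕ} {ν : Fin n → ℕ} : ν ∈ multiIdx n m ↔ ∑ j, ν j = m := by
  simp [multiIdx]

theorem isSobolevFamily_weakDeriv {σ q : ℝ} {u : Rn n → ℝ} (hu : sobolevENorm σ q u ≠ ⊤) :
    IsSobolevFamily ⌊σ⌋₊ (Int.fract σ) q (fun α => weakDeriv α u) (sobolevENorm σ q u) := by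
  have hd : ∀ m ≤ ⌊σ⌋₊, ∀ ν ∈ multiIdx n m, HasWeakDeriv ν u := by
    by_contra h
    exact hu (by rw [sobolevENorm, if_neg h])
  have hd' : ∀ α : Fin n → ℕ, ∑ j, α j ≤ ⌊σ⌋₊ → IsWeakDeriv α u (weakDeriv α u) := fun α hα =>
    (hd _ hα α (mem_multiIdx.2 rfl)).isWeakDeriv
  refine ⟨fun α hα => (hd' α hα).2.1, fun α i hα => ?_, fun α hα => ?_, fun hθ α hα => ?_⟩
  · exact (hd' α hα.le).isWeakPartial (hd' _ (by rw [sum_add_single]; omega))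
  · rw [sobolevENorm, if_pos hd]
    refine le_trans ?_ le_self_add
    refine le_trans ?_ (Finset.single_le_sum (fun _ _ => zero_le)
      (Finset.mem_range.2 (Nat.lt_succ_of_le hα)))
    exact Finset.single_le_sum (f := fun ν => eLpNorm (weakDeriv ν u) (ENNReal.ofReal q) volume)
      (fun _ _ => zero_le) (mem_multiIdx.2 rfl)
  · rw [sobolevENorm, if_pos hd, if_neg hθ]
    refine le_trans ?_ le_add_self
    exact Finset.single_le_sum (f := fun ν => slobodeckij (Int.fract σ) q (weakDeriv ν u))
      (fun _ _ => zero_le) (mem_multiIdx.2 hα)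

/-- On the one-point space `ℝ⁰` all the `L^q` norms are comparable. -/
theorem eLpNorm_le_of_dim_zero {q m : ℝ} (hq : 0 < q) (hm : 0 < m) : ∃ C : ℝ≥0∞, C ≠ ⊤ ∧
    ∀ f : Rn 0 → ℝ, eLpNorm f (ENNReal.ofReal m) volume ≤
      C * eLpNorm f (ENNReal.ofReal q) volume := by
  set V := volume (univ : Set (Rn 0)) with hV
  have hV0 : V ≠ 0 := isOpen_univ.measure_ne_zero volume univ_nonempty
  have hVt : V ≠ ⊤ := (isCompact_univ (X := Rn 0)).measure_lt_top.ne
  have e : ∀ r : ℝ, 0 < r → ∀ f : Rn 0 → ℝ,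
      eLpNorm f (ENNReal.ofReal r) volume = ‖f 0‖ₑ * V ^ (1 / r) := by
    intro r hr f
    have hf : f = fun _ => f 0 := funext fun x => congrArg f (Subsingleton.elim x 0)
    conv_lhs => rw [hf]
    rw [eLpNorm_const' _ (by simpa using hr) (by simp), ENNReal.toReal_ofReal hr.le]
  refine ⟨(V ^ (1 / q))⁻¹ * V ^ (1 / m), ENNReal.mul_ne_top ?_
    (ENNReal.rpow_ne_top_of_nonneg (by positivity) hVt), fun f => ?_⟩
  · rw [Ne, ENNReal.inv_eq_top, ENNReal.rpow_eq_zero_iff]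
    simp [hV0, hVt]
  · rw [e q hq, e m hm]
    have h1 : V ^ (1 / q) ≠ 0 := by
      rw [Ne, ENNReal.rpow_eq_zero_iff]; simp [hV0, hVt]
    have h2 : V ^ (1 / q) ≠ ⊤ := ENNReal.rpow_ne_top_of_nonneg (by positivity) hVt
    refine le_of_eq ?_
    calc ‖f 0‖ₑ * V ^ (1 / m) = ((V ^ (1 / q))⁻¹ * V ^ (1 / q)) * (‖f 0‖ₑ * V ^ (1 / m)) := by
          rw [ENNReal.inv_mul_cancel h1 h2, one_mul]
      _ = _ := by ring

/-- The derivatives of orders `i` and `j`, `i + j ≤ s`, of the two factors lie in Lebesgue spaces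
whose exponents are in Hölder's relation with `p`. -/
theorem exists_holderTriple_bound {s : ℕ} {s₁ s₂ p p₁ p₂ : ℝ} (hp1 : 1 ≤ p) (hp₁ : 1 ≤ p₁)
    (hp₂ : 1 ≤ p₂) (hs₁ : (s : ℝ) ≤ s₁) (hs₂ : (s : ℝ) ≤ s₂)
    (hp : 0 ≤ (n : ℝ) * (1 / p₁ + 1 / p₂ - 1 / p))
    (h : (n * (1 / p₁ - 1 / p) ≤ s₁ - s ∧ n * (1 / p₂ - 1 / p) ≤ s₂ - s ∧
          n * (1 / p₁ + 1 / p₂ - 1 / p) < s₁ + s₂ - s) ∨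
        (n * (1 / p₁ - 1 / p) < s₁ - s ∧ n * (1 / p₂ - 1 / p) < s₂ - s ∧
          n * (1 / p₁ + 1 / p₂ - 1 / p) ≤ s₁ + s₂ - s))
    (i j : ℕ) (hij : i + j ≤ s) :
    ∃ a b C : ℝ≥0∞, ENNReal.HolderTriple a b (ENNReal.ofReal p) ∧ C ≠ ⊤ ∧
      (∀ (D : (Fin n → ℕ) → Rn n → ℝ) (A : ℝ≥0∞), A ≠ ⊤ →
        IsSobolevFamily ⌊s₁⌋₊ (Int.fract s₁) p₁ D A →
        ∀ α, ∑ l, α l = i → eLpNorm (D α) a volume ≤ C * A) ∧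
      (∀ (D : (Fin n → ℕ) → Rn n → ℝ) (A : ℝ≥0∞), A ≠ ⊤ →
        IsSobolevFamily ⌊s₂⌋₊ (Int.fract s₂) p₂ D A →
        ∀ α, ∑ l, α l = j → eLpNorm (D α) b volume ≤ C * A) := by
  have hij' : (i : ℝ) + j ≤ s := by exact_mod_cast hij
  have hi0 : (0 : ℝ) ≤ i := Nat.cast_nonneg i
  have hj0 : (0 : ℝ) ≤ j := Nat.cast_nonneg j
  have hpp : 0 < p := by linarith
  rcases Nat.eq_zero_or_pos n with rfl | hn
  -- in dimension zero the pair `2 p, 2 p` of exponents serves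
  · obtain ⟨C₁, hC₁, H₁⟩ := eLpNorm_le_of_dim_zero (q := p₁) (m := 2 * p) (by linarith)
      (by linarith)
    obtain ⟨C₂, hC₂, H₂⟩ := eLpNorm_le_of_dim_zero (q := p₂) (m := 2 * p) (by linarith)
      (by linarith)
    refine ⟨ENNReal.ofReal (2 * p), ENNReal.ofReal (2 * p), C₁ + C₂, ⟨?_⟩,
      ENNReal.add_ne_top.2 ⟨hC₁, hC₂⟩, fun D A hA hD α hα => ?_, fun D A hA hD α hα => ?_⟩
    · rw [← ENNReal.ofReal_inv_of_pos (by linarith), ← ENNReal.ofReal_inv_of_pos hpp,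
        ← ENNReal.ofReal_add (by positivity) (by positivity)]
      congr 1
      field_simp
      norm_num
    · refine (H₁ _).trans (mul_le_mul' le_self_add (hD.eLpNorm_le α ?_))
      simp
    · refine (H₂ _).trans (mul_le_mul' le_add_self (hD.eLpNorm_le α ?_))
      simp
  have hn' : (0 : ℝ) < n := by exact_mod_cast hn
  -- division by `n` turns the hypotheses into conditions on reciprocal exponents
  have key : ∀ c t : ℝ, n * c ≤ t → c ≤ t / n := fun c t hc => by
    rw [le_div_iff₀ hn']; linarith
  have key' : ∀ c t : ℝ, n * c < t → c < t / n := fun c t hc => by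
    rw [lt_div_iff₀ hn']; linarith
  have d₁ : (s₁ - s) / n ≤ (s₁ - i) / n := by gcongr; linarith
  have d₂ : (s₂ - s) / n ≤ (s₂ - j) / n := by gcongr; linarith
  have d₃ : (s₁ + s₂ - s) / n ≤ (s₁ - i) / n + (s₂ - j) / n := by
    rw [← add_div]; gcongr; linarith
  have hi : 0 ≤ (s₁ - i) / n := div_nonneg (by linarith) hn'.le
  have hj : 0 ≤ (s₂ - j) / n := div_nonneg (by linarith) hn'.le
  have hc := nonneg_of_mul_nonneg_right hp hn'
  obtain ⟨x, y, hxy, ⟨hx0, hx₁, hx₂, hx₃⟩, ⟨hy0, hy₁, hy₂, hy₃⟩⟩ :=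
    exists_holder_exponents (P := 1 / p) (c₁ := 1 / p₁) (c₂ := 1 / p₂)
      (a₁ := 1 / p₁ - (s₁ - i) / n) (a₂ := 1 / p₂ - (s₂ - j) / n) (by positivity) (by positivity)
      (by positivity) (by linarith) (by linarith) (by linarith) (by
        rcases h with ⟨h1, h2, h3⟩ | ⟨h1, h2, h3⟩
        · have := key _ _ h1; have := key _ _ h2; have := key' _ _ h3
          exact Or.inl ⟨by linarith, by linarith, by linarith⟩
        · have := key' _ _ h1; have := key' _ _ h2; have := key _ _ h3
          exact Or.inr ⟨by linarith, by linarith, by linarith⟩)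
  obtain ⟨C₁, hC₁, H₁⟩ := exists_eLpNorm_inv_le hn (σ := s₁) (k := i) (by linarith) hp₁ hx0 hx₁
    hx₂ hx₃
  obtain ⟨C₂, hC₂, H₂⟩ := exists_eLpNorm_inv_le hn (σ := s₂) (k := j) (by linarith) hp₂ hy0 hy₁
    hy₂ hy₃
  refine ⟨(ENNReal.ofReal x)⁻¹, (ENNReal.ofReal y)⁻¹, C₁ + C₂, ⟨?_⟩,
    ENNReal.add_ne_top.2 ⟨hC₁, hC₂⟩, fun D A hA hD α hα => ?_, fun D A hA hD α hα => ?_⟩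
  · rw [inv_inv, inv_inv, ← ENNReal.ofReal_add hx0 hy0, hxy, one_div,
      ENNReal.ofReal_inv_of_pos hpp]
  · exact (H₁ D A hA hD α hα).trans (mul_le_mul' le_self_add le_rfl)
  · exact (H₂ D A hA hD α hα).trans (mul_le_mul' le_add_self le_rfl)

theorem exists_sobolevENorm_mul_le {s : ℕ} {s₁ s₂ p p₁ p₂ : ℝ} (hp1 : 1 ≤ p) (hp₁ : 1 ≤ p₁)
    (hp₂ : 1 ≤ p₂) (hs₁ : (s : ℝ) ≤ s₁) (hs₂ : (s : ℝ) ≤ s₂)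
    (hp : 0 ≤ (n : ℝ) * (1 / p₁ + 1 / p₂ - 1 / p))
    (h : (n * (1 / p₁ - 1 / p) ≤ s₁ - s ∧ n * (1 / p₂ - 1 / p) ≤ s₂ - s ∧
          n * (1 / p₁ + 1 / p₂ - 1 / p) < s₁ + s₂ - s) ∨
        (n * (1 / p₁ - 1 / p) < s₁ - s ∧ n * (1 / p₂ - 1 / p) < s₂ - s ∧
          n * (1 / p₁ + 1 / p₂ - 1 / p) ≤ s₁ + s₂ - s)) :
    ∃ C : ℝ≥0∞, C ≠ ⊤ ∧ ∀ u v : Rn n → ℝ, sobolevENorm s₁ p₁ u ≠ ⊤ → sobolevENorm s₂ p₂ v ≠ ⊤ →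
      sobolevENorm s p (u * v) ≤ C * (sobolevENorm s₁ p₁ u * sobolevENorm s₂ p₂ v) := by
  choose! a b C ht hC H₁ H₂ using exists_holderTriple_bound hp1 hp₁ hp₂ hs₁ hs₂ hp h
  set R := Finset.range (s + 1)
  set S : ℝ≥0∞ := ∑ i ∈ R, ∑ j ∈ R, if i + j ≤ s then C i j * C i j else 0 with hS
  have hSt : S ≠ ⊤ := by
    refine ENNReal.sum_ne_top.2 fun i _ => ENNReal.sum_ne_top.2 fun j _ => ?_
    split_ifs with hij
    · exact ENNReal.mul_ne_top (hC i j hij) (hC i j hij)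
    · simp
  have hCS : ∀ i j, i + j ≤ s → C i j * C i j ≤ S := by
    intro i j hij
    calc C i j * C i j = if i + j ≤ s then C i j * C i j else 0 := by rw [if_pos hij]
      _ ≤ ∑ j ∈ R, if i + j ≤ s then C i j * C i j else 0 :=
          Finset.single_le_sum (f := fun j => if i + j ≤ s then C i j * C i j else 0)
            (fun _ _ => zero_le) (Finset.mem_range.2 (by omega))
      _ ≤ S := Finset.single_le_sum
            (f := fun i => ∑ j ∈ R, if i + j ≤ s then C i j * C i j else 0)
            (fun _ _ => zero_le) (Finset.mem_range.2 (by omega))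
  have hpo : 1 ≤ ENNReal.ofReal p := by simpa using hp1
  refine ⟨(∑ m ∈ R, ((multiIdx n m).card : ℝ≥0∞) * 2 ^ m) * S, ENNReal.mul_ne_top
    (ENNReal.sum_ne_top.2 fun m _ => ENNReal.mul_ne_top (by simp) (by simp)) hSt,
    fun u v hu hv => ?_⟩
  set A₁ := sobolevENorm s₁ p₁ u with hA₁
  set A₂ := sobolevENorm s₂ p₂ v with hA₂
  have F₁ := isSobolevFamily_weakDeriv hu
  have F₂ := isSobolevFamily_weakDeriv hv
  have k₁ : s ≤ ⌊s₁⌋₊ := Nat.le_floor hs₁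
  have k₂ : s ≤ ⌊s₂⌋₊ := Nat.le_floor hs₂
  have hz₁ : weakDeriv 0 u =ᵐ[volume] u := by
    have hw : HasWeakDeriv 0 u := by
      by_contra hno
      exact hu (by rw [hA₁, sobolevENorm, if_neg fun hall =>
        hno (hall 0 (Nat.zero_le _) 0 (mem_multiIdx.2 (by simp)))])
    exact (isWeakDeriv_zero_iff hw.isWeakDeriv).symm
  have hz₂ : weakDeriv 0 v =ᵐ[volume] v := by
    have hw : HasWeakDeriv 0 v := by
      by_contra hno
      exact hv (by rw [hA₂, sobolevENorm, if_neg fun hall =>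
        hno (hall 0 (Nat.zero_le _) 0 (mem_multiIdx.2 (by simp)))])
    exact (isWeakDeriv_zero_iff hw.isWeakDeriv).symm
  have hmain : ∀ ν : Fin n → ℕ, ∑ l, ν l ≤ s → ∃ w, IsWeakDeriv ν (u * v) w ∧
      eLpNorm w (ENNReal.ofReal p) volume ≤ 2 ^ (∑ l, ν l) * (S * (A₁ * A₂)) := by
    intro ν hν
    obtain ⟨w, hw, hwb⟩ := exists_isWeakDeriv_mul (s := s) (K := S * (A₁ * A₂)) hpo
      (D₁ := fun α => weakDeriv α u) (D₂ := fun α => weakDeriv α v)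
      (fun α i hα => F₁.isWeakPartial α i (by omega))
      (fun α i hα => F₂.isWeakPartial α i (by omega))
      (fun α β hαβ => by
        have e₁ := H₁ _ _ hαβ _ _ hu F₁ α rfl
        have e₂ := H₂ _ _ hαβ _ _ hv F₂ β rfl
        refine ⟨a (∑ l, α l) (∑ l, β l), b (∑ l, α l) (∑ l, β l), ht _ _ hαβ, ⟨?_, ?_⟩, ⟨?_, ?_⟩,
          ?_⟩
        · exact (F₁.locallyIntegrable α (by omega)).aestronglyMeasurable
        · exact e₁.trans_lt (ENNReal.mul_lt_top (hC _ _ hαβ).lt_top (lt_top_iff_ne_top.2 hu))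
        · exact (F₂.locallyIntegrable β (by omega)).aestronglyMeasurable
        · exact e₂.trans_lt (ENNReal.mul_lt_top (hC _ _ hαβ).lt_top (lt_top_iff_ne_top.2 hv))
        · refine (mul_le_mul' e₁ e₂).trans ?_
          rw [mul_mul_mul_comm]
          exact mul_le_mul' (hCS _ _ hαβ) le_rfl)
      _ ν 0 0 rfl (by simpa using hν)
    exact ⟨w, hw.congr (hz₁.mul hz₂), hwb⟩
  have hall : ∀ m ≤ ⌊(s : ℝ)⌋₊, ∀ ν ∈ multiIdx n m, HasWeakDeriv ν (u * v) := by
    intro m hm ν hν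
    rw [Nat.floor_natCast] at hm
    obtain ⟨w, hw, -⟩ := hmain ν (by rw [mem_multiIdx.1 hν]; exact hm)
    exact ⟨w, hw⟩
  rw [sobolevENorm, if_pos hall, if_pos (by simp), add_zero, Nat.floor_natCast, mul_assoc,
    Finset.sum_mul]
  refine Finset.sum_le_sum fun m hm => ?_
  rw [mul_assoc, ← nsmul_eq_mul]
  refine Finset.sum_le_card_nsmul _ _ _ fun ν hν => ?_
  have hνm := mem_multiIdx.1 hν
  obtain ⟨w, hw, hwb⟩ := hmain ν (by rw [hνm]; exact Nat.lt_succ_iff.1 (Finset.mem_range.1 hm))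
  rw [eLpNorm_congr_ae hw.weakDeriv_eq, ← hνm]
  exact hwb

/-- A multiplication estimate between extended norms yields a continuous bilinear map. -/
theorem ExtNorm.exists_continuousBilinear_mul {μ : Measure (Rn n)}
    (N₁ N₂ N : ExtNorm (Rn n →ₘ[μ] ℝ)) {C : ℝ≥0∞} (hC : C ≠ ⊤)
    (h : ∀ u v, N₁.toFun u < ⊤ → N₂.toFun v < ⊤ →
      N.toFun (u * v) ≤ C * (N₁.toFun u * N₂.toFun v)) :
    ∃ B : N₁.finiteSubspace →L[ℝ] N₂.finiteSubspace →L[ℝ] N.finiteSubspace,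
      ∀ (u : N₁.finiteSubspace) (v : N₂.finiteSubspace),
        ((B u v : Rn n →ₘ[μ] ℝ) : Rn n → ℝ) =ᵐ[μ]
          fun x => (u : Rn n →ₘ[μ] ℝ) x * (v : Rn n →ₘ[μ] ℝ) x := by
  have hmem : ∀ (u : N₁.finiteSubspace) (v : N₂.finiteSubspace),
      u.1 * v.1 ∈ N.finiteSubspace := fun u v =>
    (h u.1 v.1 u.2 v.2).trans_lt (ENNReal.mul_lt_top hC.lt_top (ENNReal.mul_lt_top u.2 v.2))
  have hsmul : ∀ (c : ℝ) (f g : Rn n →ₘ[μ] ℝ), c • f * g = c • (f * g) := by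
    intro c f g
    refine AEEqFun.induction_on₂ f g fun f hf g hg => ?_
    change AEEqFun.mk (c • f * g) ((hf.const_smul c).mul hg) =
      AEEqFun.mk (c • (f * g)) ((hf.mul hg).const_smul c)
    simp only [smul_mul_assoc]
  have hadd : ∀ f₁ f₂ g : Rn n →ₘ[μ] ℝ, (f₁ + f₂) * g = f₁ * g + f₂ * g := by
    intro f₁ f₂ g
    refine AEEqFun.induction_on₃ f₁ f₂ g fun f₁ h₁ f₂ h₂ g hg => ?_
    change AEEqFun.mk ((f₁ + f₂) * g) ((h₁.add h₂).mul hg) =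
      AEEqFun.mk (f₁ * g + f₂ * g) ((h₁.mul hg).add (h₂.mul hg))
    simp only [add_mul]
  let L : N₁.finiteSubspace →ₗ[ℝ] N₂.finiteSubspace →ₗ[ℝ] N.finiteSubspace :=
    LinearMap.mk₂ ℝ (fun u v => ⟨u.1 * v.1, hmem u v⟩)
      (fun _ _ _ => Subtype.ext (hadd _ _ _))
      (fun _ _ _ => Subtype.ext (hsmul _ _ _))
      (fun u v w => Subtype.ext (by
        change u.1 * (v.1 + w.1) = u.1 * v.1 + u.1 * w.1
        rw [mul_comm, hadd, mul_comm v.1, mul_comm w.1]))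
      (fun c u v => Subtype.ext (by
        change u.1 * (c • v.1) = c • (u.1 * v.1)
        rw [mul_comm, hsmul, mul_comm]))
  refine ⟨L.mkContinuous₂ C.toReal fun u v => ?_, fun u v => ?_⟩
  · rw [mul_assoc, ExtNorm.norm_def, ExtNorm.norm_def, ExtNorm.norm_def, ← ENNReal.toReal_mul,
      ← ENNReal.toReal_mul]
    exact ENNReal.toReal_mono
      (ENNReal.mul_lt_top hC.lt_top (ENNReal.mul_lt_top u.2 v.2)).ne (h u.1 v.1 u.2 v.2)
  · rw [LinearMap.mkContinuous₂_apply]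
    exact AEEqFun.coeFn_mul u.1 v.1

/-- The estimate on `ℝⁿ` passes to the quotient norms on `Ω`: the product of extensions extends
the product. -/
theorem sobolevExtNormOn_mul_le {s s₁ s₂ p p₁ p₂ : ℝ} [Fact (1 ≤ p)] [Fact (1 ≤ p₁)]
    [Fact (1 ≤ p₂)] {C : ℝ≥0∞} (Ω : Set (Rn n))
    (h : ∀ u v : Rn n → ℝ, sobolevENorm s₁ p₁ u ≠ ⊤ → sobolevENorm s₂ p₂ v ≠ ⊤ →
      sobolevENorm s p (u * v) ≤ C * (sobolevENorm s₁ p₁ u * sobolevENorm s₂ p₂ v))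
    (hC : C ≠ ⊤) (u v : Rn n →ₘ[volume.restrict Ω] ℝ)
    (hu : (sobolevExtNormOn Ω s₁ p₁).toFun u < ⊤) (hv : (sobolevExtNormOn Ω s₂ p₂).toFun v < ⊤) :
    (sobolevExtNormOn Ω s p).toFun (u * v) ≤
      C * ((sobolevExtNormOn Ω s₁ p₁).toFun u * (sobolevExtNormOn Ω s₂ p₂).toFun v) := by
  set a := (sobolevExtNormOn Ω s₁ p₁).toFun u with ha
  set b := (sobolevExtNormOn Ω s₂ p₂).toFun v with hb
  have key : ∀ a' b' : ℝ≥0∞, a < a' → b < b' → (sobolevExtNormOn Ω s p).toFun (u * v) ≤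
      C * (a' * b') := by
    intro a' b' haa hbb
    obtain ⟨U, hU⟩ := iInf_lt_iff.1 haa
    obtain ⟨V, hV⟩ := iInf_lt_iff.1 hbb
    have hUV : (U.1 * V.1 : Rn n →ₘ[volume] ℝ) =ᵐ[volume.restrict Ω] (u * v : _ →ₘ[_] ℝ) := by
      filter_upwards [U.2, V.2, AEEqFun.coeFn_mul u v,
        ae_restrict_of_ae (AEEqFun.coeFn_mul U.1 V.1)] with x h1 h2 h3 h4
      rw [h3, h4, Pi.mul_apply, Pi.mul_apply, h1, h2]
    refine (iInf_le _ ⟨U.1 * V.1, hUV⟩).trans ?_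
    rw [sobolevENorm_congr s p (AEEqFun.coeFn_mul U.1 V.1)]
    refine (h _ _ hU.ne_top hV.ne_top).trans ?_
    gcongr
  have hlim : Tendsto (fun j : ℕ => C * ((a + (j + 1 : ℝ≥0∞)⁻¹) * (b + (j + 1 : ℝ≥0∞)⁻¹))) atTop
      (nhds (C * (a * b))) := by
    have h0 : Tendsto (fun j : ℕ => ((j : ℝ≥0∞) + 1)⁻¹) atTop (nhds 0) := by
      have := (tendsto_add_atTop_iff_nat 1).2 ENNReal.tendsto_inv_nat_nhds_zero
      simpa using this
    have h1 : Tendsto (fun j : ℕ => a + ((j : ℝ≥0∞) + 1)⁻¹) atTop (nhds a) := by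
      simpa using h0.const_add a
    have h2 : Tendsto (fun j : ℕ => b + ((j : ℝ≥0∞) + 1)⁻¹) atTop (nhds b) := by
      simpa using h0.const_add b
    exact ENNReal.Tendsto.const_mul
      (ENNReal.Tendsto.mul h1 (Or.inr hv.ne) h2 (Or.inr hu.ne)) (Or.inr hC)
  refine ge_of_tendsto' hlim fun j => key _ _ ?_ ?_
  · exact ENNReal.lt_add_right hu.ne (by simp)
  · exact ENNReal.lt_add_right hv.ne (by simp)

end

theorem theorem6p1 (n : ℕ) (s : ℕ) (s₁ s₂ p p₁ p₂ : ℝ)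
    [Fact (1 ≤ p)] [Fact (1 ≤ p₁)] [Fact (1 ≤ p₂)]
    (hs₁ : (s : ℝ) ≤ s₁) (hs₂ : (s : ℝ) ≤ s₂)
    (hp : 0 ≤ (n : ℝ) * (1 / p₁ + 1 / p₂ - 1 / p))
    (h : (n * (1 / p₁ - 1 / p) ≤ s₁ - s ∧ n * (1 / p₂ - 1 / p) ≤ s₂ - s ∧
          n * (1 / p₁ + 1 / p₂ - 1 / p) < s₁ + s₂ - s) ∨
        (n * (1 / p₁ - 1 / p) < s₁ - s ∧ n * (1 / p₂ - 1 / p) < s₂ - s ∧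
          n * (1 / p₁ + 1 / p₂ - 1 / p) ≤ s₁ + s₂ - s)) :
    (∃ B : SobolevSpace n s₁ p₁ →L[ℝ] SobolevSpace n s₂ p₂ →L[ℝ] SobolevSpace n s p,
      ∀ (u : SobolevSpace n s₁ p₁) (v : SobolevSpace n s₂ p₂),
        ((B u v : Rn n →ₘ[volume] ℝ) : Rn n → ℝ) =ᵐ[volume]
        fun x => (u : Rn n →ₘ[volume] ℝ) x * (v : Rn n →ₘ[volume] ℝ) x) ∧
    ∀ Ω : Set (Rn n), IsOpen Ω →
      ∃ B : SobolevSpaceOn Ω s₁ p₁ →L[ℝ] SobolevSpaceOn Ω s₂ p₂ →L[ℝ] SobolevSpaceOn Ω s p,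
        ∀ (u : SobolevSpaceOn Ω s₁ p₁) (v : SobolevSpaceOn Ω s₂ p₂),
          ((B u v : Rn n →ₘ[volume.restrict Ω] ℝ) : Rn n → ℝ) =ᵐ[volume.restrict Ω]
          fun x => (u : Rn n →ₘ[volume.restrict Ω] ℝ) x *
            (v : Rn n →ₘ[volume.restrict Ω] ℝ) x := by
  obtain ⟨C, hC, H⟩ := exists_sobolevENorm_mul_le (n := n) (s := s) (p := p) Fact.out Fact.out
    Fact.out hs₁ hs₂ hp h
  refine ⟨ExtNorm.exists_continuousBilinear_mul _ _ _ hC fun u v hu hv => ?_, fun Ω _ =>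
    ExtNorm.exists_continuousBilinear_mul _ _ _ hC (sobolevExtNormOn_mul_le Ω H hC)⟩
  refine le_trans (le_of_eq ?_) (H u v hu.ne hv.ne)
  exact sobolevENorm_congr s p (AEEqFun.coeFn_mul u v)
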